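/- Let $r\ge 3$ be a fixed integer. For $n\ge 1$ let $[n]^{(r)}$ be the family of all $r$-element subsets of $[n]=\{1,\dots,n\}$. A pair $(\mathcal A,\mathcal B)$ of families $\mathcal A,\mathcal B\subseteq[n]^{(r)}$ is called $2$-cross-avoiding if $|A\cap B|\ne 2$ for all $A\in\mathcal A$, $B\in\mathcal B$. Let $d(\mathcal A,\mathcal B)$ be the number of pairs $(A,B)\in\mathcal A\times\mathcal B$ with $A\cap B=\varnothing$, and let $p(n,r,2)$ and $d(n,r,2)$ be the maxima of $|\mathcal A||\mathcal B|$ and of $d(\mathcal A,\mathcal B)$, respectively, over all $2$-cross-avoiding pairs $\mathcal A,\mathcal B\subseteq[n]^{(r)}$. Put $$g_r(\alpha)=\alpha^r(1-\alpha)^r+r\alpha^{r+1}(1-\alpha)^{r-1},\qquad \gamma_r=\max_{\alpha\in[0,1]}g_r(\alpha).$$ Then, as $n\to\infty$, with $o(1)$ terms depending only on $r$ and $n$ in (1)–(3): (1) every $2$-cross-avoiding pair $\mathcal A,\mathcal B\subseteq[n]^{(r)}$ satisfies $|\mathcal A||\mathcal B|\le(\gamma_r+o(1))\binom nr^2$;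 (2) this is asymptotically tight: $p(n,r,2)=(\gamma_r+o(1))\binom nr^2$; (3) $d(n,r,2)=(\gamma_r+o(1))\binom nr^2$; (4) for $X\subseteq[n]$ and $s\ge 0$ let $\mathcal F_{X,s}=\{F\in[n]^{(r)}:|F\cap X|\ge r-s\}$. If $\alpha\in[0,1]$ satisfies $g_r(\alpha)=\gamma_r$ and $X=X_n\subseteq[n]$ satisfies $|X_n|/n\to 1-\alpha$, then $(\mathcal F_{X,1},\mathcal F_{X^c,0})$ is a $2$-cross-avoiding pair for every $n$, and both $|\mathcal F_{X,1}||\mathcal F_{X^c,0}|$ and $d(\mathcal F_{X,1},\mathcal F_{X^c,0})$ equal $(\gamma_r+o(1))\binom nr^2$. -/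

import Mathlib

open Filter Topology

/-- `(𝒜, ℬ)` is `t`-cross-avoiding: no member of `𝒜` meets a member of `ℬ` in exactly `t` points. -/
def CrossAvoiding {n : ℕ} (t : ℕ) (𝒜 ℬ : Finset (Finset (Fin n))) : Prop :=
  ∀ A ∈ 𝒜, ∀ B ∈ ℬ, (A ∩ B).card ≠ t

/-- The number of pairs `(A, B) ∈ 𝒜 × ℬ` with `A ∩ B = ∅`. -/
def disjointPairs {n : ℕ} (𝒜 ℬ : Finset (Finset (Fin n))) : ℕ :=
  ((𝒜 ×ˢ ℬ).filter (fun P => P.1 ∩ P.2 = ∅)).card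

/-- `(𝒜, ℬ)` is a `t`-cross-avoiding pair of `r`-uniform families on an `n`-element ground set. -/
def UniformAvoidingPair (n r t : ℕ) (𝒜 ℬ : Finset (Finset (Fin n))) : Prop :=
  (𝒜 : Set (Finset (Fin n))).Sized r ∧ (ℬ : Set (Finset (Fin n))).Sized r ∧ CrossAvoiding t 𝒜 ℬ

/-- The set of values of `|𝒜||ℬ|` over `t`-cross-avoiding `r`-uniform pairs. -/
def productValues (n r t : ℕ) : Set ℕ :=
  {m | ∃ 𝒜 ℬ : Finset (Finset (Fin n)), UniformAvoidingPair n r t 𝒜 ℬ ∧ m = 𝒜.card * ℬ.card}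

/-- The set of values of `d(𝒜, ℬ)` over `t`-cross-avoiding `r`-uniform pairs. -/
def disjointValues (n r t : ℕ) : Set ℕ :=
  {m | ∃ 𝒜 ℬ : Finset (Finset (Fin n)), UniformAvoidingPair n r t 𝒜 ℬ ∧ m = disjointPairs 𝒜 ℬ}

/-- `p(n, r, t)`, the maximum of `|𝒜||ℬ|`. -/
noncomputable def maxProduct (n r t : ℕ) : ℕ := sSup (productValues n r t)

/-- `d(n, r, t)`, the maximum of `d(𝒜, ℬ)`. -/
noncomputable def maxDisjoint (n r t : ℕ) : ℕ := sSup (disjointValues n r t)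

theorem uniformAvoidingPair_empty (n r t : ℕ) : UniformAvoidingPair n r t ∅ ∅ := by
  refine ⟨?_, ?_, ?_⟩ <;> simp [Set.Sized, CrossAvoiding]

/-- The supremum defining `p(n, r, t)` is a maximum. -/
theorem maxProduct_isGreatest (n r t : ℕ) :
    IsGreatest (productValues n r t) (maxProduct n r t) := by
  have hne : (productValues n r t).Nonempty := ⟨_, ∅, ∅, uniformAvoidingPair_empty n r t, rfl⟩
  have hb : BddAbove (productValues n r t) := by
    refine ⟨Fintype.card (Finset (Fin n)) * Fintype.card (Finset (Fin n)), ?_⟩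
    rintro m ⟨𝒜, ℬ, -, rfl⟩
    exact Nat.mul_le_mul (Finset.card_le_univ _) (Finset.card_le_univ _)
  exact ⟨Nat.sSup_mem hne hb, fun m hm => le_csSup hb hm⟩

/-- The supremum defining `d(n, r, t)` is a maximum. -/
theorem maxDisjoint_isGreatest (n r t : ℕ) :
    IsGreatest (disjointValues n r t) (maxDisjoint n r t) := by
  have hne : (disjointValues n r t).Nonempty := ⟨_, ∅, ∅, uniformAvoidingPair_empty n r t, rfl⟩
  have hb : BddAbove (disjointValues n r t) := by
    refine ⟨Fintype.card (Finset (Fin n) × Finset (Fin n)), ?_⟩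
    rintro m ⟨𝒜, ℬ, -, rfl⟩
    exact Finset.card_le_univ _
  exact ⟨Nat.sSup_mem hne hb, fun m hm => le_csSup hb hm⟩

/-- The function `α ↦ α^r (1 - α)^r + r α^(r+1) (1 - α)^(r-1)` (used for `r ≥ 3`). -/
def gammaFun (r : ℕ) (α : ℝ) : ℝ :=
  α ^ r * (1 - α) ^ r + (r : ℝ) * α ^ (r + 1) * (1 - α) ^ (r - 1)

/-- `γ_r`, the maximum of `gammaFun r` over `[0, 1]`. -/
noncomputable def gammaConst (r : ℕ) : ℝ := sSup (gammaFun r '' Set.Icc 0 1)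

/-- The supremum defining `γ_r` is a maximum. -/
theorem gammaConst_isGreatest (r : ℕ) :
    IsGreatest (gammaFun r '' Set.Icc 0 1) (gammaConst r) := by
  have hc : Continuous (gammaFun r) := by
    unfold gammaFun
    fun_prop
  exact (isCompact_Icc.image hc).isGreatest_sSup
    ((Set.nonempty_Icc.2 zero_le_one).image _)

/-- `F_{X,s}`: the `r`-subsets `F` of the ground set with `|F ∩ X| ≥ r - s`. -/
def starFamily {n : ℕ} (r : ℕ) (X : Finset (Fin n)) (s : ℕ) : Finset (Finset (Fin n)) :=
  (Finset.powersetCard r Finset.univ).filter (fun F => r ≤ (F ∩ X).card + s)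

/-! Call a member of 𝒜 poor if it contains a pair lying in at most r n^(r-3) members of 𝒜. There are
O(n^(r-1)) poor members, so they may be discarded. Afterwards every A and B share at most one point:
if they shared a pair P, each of the many members of 𝒜 through P would need a further point of B,
and too few have one (`card_inter_le_one_of_mem_richMembers`).

This condition survives shifting 𝒜 to the left and ℬ to the right (`exists_shifted`). On an interval
of the ground set, either some A contains both ends, hence no B does, and shiftedness isolates the
left end for ℬ within the interval; or no A does, and the right end is isolated for 𝒜. Peeling off
such ends bounds |𝒜| and |ℬ| by the r-clique counts of a threshold graph and of its complement, up
to the factor r! (`exists_pathSum_ge`).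

It remains to maximise the product of these two clique densities. For a fixed number of alternating
parts a maximiser exists by compactness. Empty parts can be removed. With at least three parts, all
positive, the first-order conditions produce a direction in which the second derivative is positive
(`false_of_isLocalMax_threePart`). So two parts suffice: a clique of size 1 - α joined to an
independent set of size α, whose product is `gammaFun r α`.

The star families realise this structure. All but O(n^(2r-1)) pairs of r-sets are disjoint, so the
maximum number of disjoint pairs has the same asymptotics. -/

/-! ### Clique densities of threshold graphs given by lists of part sizes. -/

/-- The number of cliques of order `r` (up to the factor `r!`) of a continuous threshold graph whose
consecutive parts have the sizes in the list. If the flag is `true`, the first part is a clique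
joined to the rest; otherwise it is an independent set. The parts alternate, and the real argument
is the total size of the clique parts that precede the list. -/
def pathSum (r : ℕ) : Bool → List ℝ → ℝ → ℝ
  | _, [], _ => 0
  | true, l :: L, x => (x + l) ^ r - x ^ r + pathSum r false L (x + l)
  | false, l :: L, x => r * x ^ (r - 1) * l + pathSum r true L x

theorem pathSum_nil (r : ℕ) (s : Bool) (x : ℝ) : pathSum r s [] x = 0 := by
  cases s <;> rfl

theorem pathSum_true_cons (r : ℕ) (l : ℝ) (L : List ℝ) (x : ℝ) :
    pathSum r true (l :: L) x = (x + l) ^ r - x ^ r + pathSum r false L (x + l) := rfl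

theorem pathSum_false_cons (r : ℕ) (l : ℝ) (L : List ℝ) (x : ℝ) :
    pathSum r false (l :: L) x = r * x ^ (r - 1) * l + pathSum r true L x := rfl

/-- An empty part only switches the type of the next one; this lets a list with strictly alternating
types encode any sequence of peeled vertices. -/
theorem pathSum_zero_cons (r : ℕ) (s : Bool) (L : List ℝ) (x : ℝ) :
    pathSum r s (0 :: L) x = pathSum r (!s) L x := by
  cases s <;> simp [pathSum]

theorem pathSum_append_zero (r : ℕ) (s : Bool) (L : List ℝ) (x : ℝ) :
    pathSum r s (L ++ [0]) x = pathSum r s L x := by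
  induction L generalizing s x with
  | nil => cases s <;> simp [pathSum]
  | cons l L ih => cases s <;> simp [pathSum, ih]

theorem pathSum_merge (r : ℕ) (s : Bool) (L R : List ℝ) (u v x : ℝ) :
    pathSum r s (L ++ u :: 0 :: v :: R) x = pathSum r s (L ++ (u + v) :: R) x := by
  induction L generalizing s x with
  | nil =>
    cases s
    · simp [pathSum]; ring
    · simp [pathSum, add_assoc]; ring
  | cons l L ih => cases s <;> simp [pathSum, ih]

theorem pathSum_scale (r : ℕ) (hr : 1 ≤ r) (s : Bool) (L : List ℝ) (c x : ℝ) :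
    pathSum r s (L.map (c * ·)) (c * x) = c ^ r * pathSum r s L x := by
  obtain ⟨k, rfl⟩ := Nat.exists_eq_add_of_le' hr
  induction L generalizing s x with
  | nil => simp [pathSum_nil]
  | cons l L ih =>
    cases s
    · simp only [List.map_cons, pathSum_false_cons, ih]
      simp; ring
    · simp only [List.map_cons, pathSum_true_cons, ← mul_add, ih]
      simp only [mul_pow]; ring

theorem pathSum_nonneg (r : ℕ) (s : Bool) (L : List ℝ) (hL : ∀ l ∈ L, 0 ≤ l) {x : ℝ} (hx : 0 ≤ x) :
    0 ≤ pathSum r s L x := by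
  induction L generalizing s x with
  | nil => simp [pathSum_nil]
  | cons l L ih =>
    have hl : 0 ≤ l := hL l (by simp)
    have hL' : ∀ l ∈ L, 0 ≤ l := fun y hy => hL y (by simp [hy])
    cases s
    · rw [pathSum_false_cons]
      have := ih true hL' hx
      positivity
    · rw [pathSum_true_cons]
      have h1 := ih false hL' (add_nonneg hx hl)
      have h2 : x ^ r ≤ (x + l) ^ r := by gcongr; linarith
      linarith

/-- Continuity is joint in the parts and the initial total because the recursion moves the first
part into that total. -/
theorem continuous_pathSum_ofFn (r : ℕ) (N : ℕ) (s : Bool) :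
    Continuous fun z : (Fin N → ℝ) × ℝ => pathSum r s (List.ofFn z.1) z.2 := by
  induction N generalizing s with
  | zero => simpa [pathSum_nil] using continuous_const
  | succ N ih =>
    cases s
    · simp only [List.ofFn_succ, pathSum_false_cons]
      have h := (ih true).comp (g := fun z : (Fin N → ℝ) × ℝ => pathSum r true (List.ofFn z.1) z.2)
        (f := fun z : (Fin (N + 1) → ℝ) × ℝ => ((fun i => z.1 i.succ), z.2)) (by fun_prop)
      exact (by fun_prop : Continuous fun z : (Fin (N + 1) → ℝ) × ℝ =>
        (r : ℝ) * z.2 ^ (r - 1) * z.1 0).add h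
    · simp only [List.ofFn_succ, pathSum_true_cons]
      have h := (ih false).comp (g := fun z : (Fin N → ℝ) × ℝ => pathSum r false (List.ofFn z.1) z.2)
        (f := fun z : (Fin (N + 1) → ℝ) × ℝ => ((fun i => z.1 i.succ), z.2 + z.1 0)) (by fun_prop)
      exact (by fun_prop : Continuous fun z : (Fin (N + 1) → ℝ) × ℝ =>
        (z.2 + z.1 0) ^ r - z.2 ^ r).add h

/-- `pathSum` is twice differentiable with nonnegative derivatives on the nonnegative half-line. -/
theorem exists_deriv_pathSum (r : ℕ) (s : Bool) (L : List ℝ) (hL : ∀ l ∈ L, 0 ≤ l) :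
    ∃ f₁ f₂ : ℝ → ℝ, (∀ x, HasDerivAt (pathSum r s L) (f₁ x) x) ∧
      (∀ x, HasDerivAt f₁ (f₂ x) x) ∧ ∀ x, 0 ≤ x → 0 ≤ f₁ x ∧ 0 ≤ f₂ x := by
  induction L generalizing s with
  | nil =>
    refine ⟨fun _ => 0, fun _ => 0, fun x => ?_, fun x => hasDerivAt_const x 0, by simp⟩
    have : pathSum r s [] = fun _ => 0 := funext fun x => pathSum_nil r s x
    rw [this]; exact hasDerivAt_const x 0
  | cons l L ih =>
    have hl : 0 ≤ l := hL l (by simp)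
    have hL' : ∀ l ∈ L, 0 ≤ l := fun y hy => hL y (by simp [hy])
    cases s
    · obtain ⟨f₁, f₂, h₁, h₂, h₃⟩ := ih true hL'
      refine ⟨fun x => r * (((r - 1 : ℕ) : ℝ) * x ^ (r - 1 - 1)) * l + f₁ x,
        fun x => r * (((r - 1 : ℕ) : ℝ) * (((r - 1 - 1 : ℕ) : ℝ) * x ^ (r - 1 - 1 - 1))) * l + f₂ x,
        fun x => ?_, fun x => ?_, fun x hx => ?_⟩
      · exact (((hasDerivAt_pow (r - 1) x).const_mul (r : ℝ)).mul_const l).add (h₁ x)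
      · exact ((((hasDerivAt_pow (r - 1 - 1) x).const_mul ((r - 1 : ℕ) : ℝ)).const_mul
          (r : ℝ)).mul_const l).add (h₂ x)
      · have := h₃ x hx
        constructor
        · exact add_nonneg (by positivity) this.1
        · exact add_nonneg (by positivity) this.2
    · obtain ⟨f₁, f₂, h₁, h₂, h₃⟩ := ih false hL'
      refine ⟨fun x => r * (x + l) ^ (r - 1) - r * x ^ (r - 1) + f₁ (x + l),
        fun x => r * (((r - 1 : ℕ) : ℝ) * (x + l) ^ (r - 1 - 1)) -
          r * (((r - 1 : ℕ) : ℝ) * x ^ (r - 1 - 1)) + f₂ (x + l),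
        fun x => ?_, fun x => ?_, fun x hx => ?_⟩
      · exact (((hasDerivAt_pow r (x + l)).comp_add_const x l).sub (hasDerivAt_pow r x)).add
          ((h₁ (x + l)).comp_add_const x l)
      · exact (((((hasDerivAt_pow (r - 1) (x + l)).const_mul (r : ℝ))).comp_add_const x l).sub
          ((hasDerivAt_pow (r - 1) x).const_mul (r : ℝ))).add ((h₂ (x + l)).comp_add_const x l)
      · have := h₃ (x + l) (by linarith)
        have hxl : x ≤ x + l := by linarith
        constructor
        · refine add_nonneg (sub_nonneg.2 ?_) this.1
          gcongr
        · refine add_nonneg (sub_nonneg.2 ?_) this.2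
          gcongr

/-! ### First and second variation of the first three parts. -/

theorem IsLocalMax.hasDerivAt_hasDerivAt_nonpos {f f' : ℝ → ℝ} {c a : ℝ} (h : IsLocalMax f a)
    (hf : ∀ x, HasDerivAt f (f' x) x) (hf' : HasDerivAt f' c a) : c ≤ 0 := by
  by_contra! hc
  have hd : deriv f = f' := funext fun x => (hf x).deriv
  -- A positive second derivative makes `a` a local minimum as well, so `f` is constant near `a` and
  -- the second derivative vanishes.
  have hmin := isLocalMin_of_deriv_deriv_pos (f := f) (x₀ := a) (by rw [hd, hf'.deriv]; exact hc)
    (h.deriv_eq_zero) (hf a).continuousAt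
  have hconst : f =ᶠ[𝓝 a] fun _ => f a := by
    filter_upwards [h, hmin] with x h1 h2 using le_antisymm h1 h2
  have h1 : deriv f =ᶠ[𝓝 a] deriv fun _ => f a := hconst.deriv
  have h2 := h1.deriv_eq
  rw [hd, hf'.deriv] at h2
  simp at h2
  exact hc.ne' h2

theorem hasDerivAt_affine_pow (n : ℕ) (a α t : ℝ) :
    HasDerivAt (fun t => (a + t * α) ^ (n + 1)) ((n + 1) * (a + t * α) ^ n * α) t := by
  have h : HasDerivAt (fun t : ℝ => a + t * α) α t := by
    simpa using ((hasDerivAt_id t).mul_const α).const_add a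
  exact (h.pow (n + 1)).congr_deriv (by simp)

theorem hasDerivAt_comp_affine {f f' : ℝ → ℝ} (hf : ∀ x, HasDerivAt f (f' x) x) (a α t : ℝ) :
    HasDerivAt (fun t => f (a + t * α)) (f' (a + t * α) * α) t := by
  have h : HasDerivAt (fun t : ℝ => a + t * α) α t := by
    simpa using ((hasDerivAt_id t).mul_const α).const_add a
  exact (hf (a + t * α)).comp t h

/-- The contribution of the first three parts of a path, as a function of the part sizes. -/
def threePart (k : ℕ) (f : ℝ → ℝ) (a b p : ℝ) : ℝ :=
  (k + 3) * (a ^ (k + 2) * b) + p ^ (k + 3) + f p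

theorem hasDerivAt_threePart (k : ℕ) {f f₁ : ℝ → ℝ} (hf : ∀ x, HasDerivAt f (f₁ x) x)
    (a α b β p π t : ℝ) :
    HasDerivAt (fun t => threePart k f (a + t * α) (b + t * β) (p + t * π))
      ((k + 3) * ((k + 2) * (a + t * α) ^ (k + 1) * α * (b + t * β) + (a + t * α) ^ (k + 2) * β) +
        (k + 3) * (p + t * π) ^ (k + 2) * π + f₁ (p + t * π) * π) t := by
  have hb : HasDerivAt (fun t : ℝ => b + t * β) β t := by
    simpa using ((hasDerivAt_id t).mul_const β).const_add b
  have h1 := hasDerivAt_affine_pow (k + 1) a α t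
  have h2 := hasDerivAt_affine_pow (k + 2) p π t
  have h := (((h1.mul hb).const_mul ((k : ℝ) + 3)).add h2).add (hasDerivAt_comp_affine hf p π t)
  refine h.congr_deriv ?_
  push_cast; ring

theorem hasDerivAt_deriv_threePart (k : ℕ) {f₁ f₂ : ℝ → ℝ} (hf : ∀ x, HasDerivAt f₁ (f₂ x) x)
    (a α b β p π t : ℝ) :
    HasDerivAt (fun t => ((k : ℝ) + 3) * ((k + 2) * (a + t * α) ^ (k + 1) * α * (b + t * β) +
        (a + t * α) ^ (k + 2) * β) + (k + 3) * (p + t * π) ^ (k + 2) * π + f₁ (p + t * π) * π)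
      ((k + 3) * ((k + 2) * (k + 1) * (a + t * α) ^ k * α ^ 2 * (b + t * β) +
        2 * (k + 2) * (a + t * α) ^ (k + 1) * α * β) +
        (k + 3) * (k + 2) * (p + t * π) ^ (k + 1) * π ^ 2 + f₂ (p + t * π) * π ^ 2) t := by
  have hb : HasDerivAt (fun t : ℝ => b + t * β) β t := by
    simpa using ((hasDerivAt_id t).mul_const β).const_add b
  have h1 := hasDerivAt_affine_pow k a α t
  have h2 := hasDerivAt_affine_pow (k + 1) a α t
  have h3 := hasDerivAt_affine_pow (k + 1) p π t
  have h := (((((h1.const_mul ((k : ℝ) + 2)).mul_const α).mul hb).add (h2.mul_const β)).const_mul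
    ((k : ℝ) + 3)).add ((h3.const_mul ((k : ℝ) + 3)).mul_const π)
  have h' := h.add ((hasDerivAt_comp_affine hf p π t).mul_const π)
  refine h'.congr_deriv ?_
  push_cast; ring

/-- A consequence of Bernoulli-type bounds: if `(1 + x)^m - 1 ≥ m² x` then `m x > 1`. -/
theorem lt_mul_of_pow_sub_pow (k : ℕ) {a c : ℝ} (ha : 0 < a) (hc : 0 < c)
    (h : ((k : ℝ) + 2) ^ 2 * a ^ (k + 1) * c ≤ (a + c) ^ (k + 2) - a ^ (k + 2)) :
    a < (k + 2) * c := by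
  by_contra! hle
  have hk : (0 : ℝ) < (k : ℝ) + 2 := by positivity
  -- With m = k + 2 this is (1 + 1/m)^m < m + 1, true because the left side is at most e < 3.
  have hE : ((k : ℝ) + 3) ^ (k + 2) < ((k : ℝ) + 3) * (k + 2) ^ (k + 2) := by
    have h1 : (1 : ℝ) + 1 / (k + 2) ≤ Real.exp (1 / (k + 2)) := by
      have := Real.add_one_le_exp (1 / ((k : ℝ) + 2)); linarith
    have h2 : ((1 : ℝ) + 1 / (k + 2)) ^ (k + 2) ≤ Real.exp 1 := by
      calc ((1 : ℝ) + 1 / (k + 2)) ^ (k + 2) ≤ Real.exp (1 / (k + 2)) ^ (k + 2) := by gcongr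
        _ = Real.exp 1 := by
          rw [← Real.exp_nat_mul]; congr 1; push_cast; field_simp
    have h3 := Real.exp_one_lt_d9
    have h4 : ((1 : ℝ) + 1 / (k + 2)) ^ (k + 2) < k + 3 := by
      have : (0 : ℝ) ≤ k := by positivity
      linarith
    have h5 : ((k : ℝ) + 3) ^ (k + 2) = ((1 : ℝ) + 1 / (k + 2)) ^ (k + 2) * (k + 2) ^ (k + 2) := by
      rw [← mul_pow]; congr 1; field_simp; ring
    rw [h5]
    exact mul_lt_mul_of_pos_right h4 (by positivity)
  have hgeom : (a + c) ^ (k + 2) - a ^ (k + 2) =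
      c * ∑ i ∈ Finset.range (k + 2), (a + c) ^ i * a ^ (k + 2 - 1 - i) := by
    have := (Commute.all (a + c) a).geom_sum₂_mul (k + 2)
    rw [← this]; ring
  have hgeom' : ((k : ℝ) + 3) ^ (k + 2) - (k + 2) ^ (k + 2) =
      ∑ i ∈ Finset.range (k + 2), ((k : ℝ) + 3) ^ i * (k + 2) ^ (k + 2 - 1 - i) := by
    have := (Commute.all ((k : ℝ) + 3) (k + 2)).geom_sum₂_mul (k + 2)
    rw [← this]; ring
  have hle' : ((k : ℝ) + 2) * (a + c) ≤ (k + 3) * a := by linarith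
  -- The quotient ((1 + x)^m - 1)/x is a geometric sum increasing in x = c/a; it is compared term by
  -- term with its value at x = 1/m.
  have hsum : ((k : ℝ) + 2) ^ (k + 1) *
      ∑ i ∈ Finset.range (k + 2), (a + c) ^ i * a ^ (k + 2 - 1 - i) ≤
      a ^ (k + 1) * ∑ i ∈ Finset.range (k + 2), ((k : ℝ) + 3) ^ i * (k + 2) ^ (k + 2 - 1 - i) := by
    rw [Finset.mul_sum, Finset.mul_sum]
    refine Finset.sum_le_sum fun i hi => ?_
    obtain ⟨j, hj⟩ : ∃ j, k + 1 = i + j := Nat.exists_eq_add_of_le (by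
      have := Finset.mem_range.1 hi; omega)
    have hj' : k + 2 - 1 - i = j := by omega
    rw [hj', hj]
    calc ((k : ℝ) + 2) ^ (i + j) * ((a + c) ^ i * a ^ j)
        = ((k + 2) * (a + c)) ^ i * ((k + 2) ^ j * a ^ j) := by rw [mul_pow]; ring
      _ ≤ ((k + 3) * a) ^ i * ((k + 2) ^ j * a ^ j) := by gcongr
      _ = a ^ (i + j) * (((k : ℝ) + 3) ^ i * (k + 2) ^ j) := by rw [mul_pow]; ring
  rw [← hgeom'] at hsum
  rw [hgeom] at h
  have h1 : ((k : ℝ) + 2) ^ 2 * a ^ (k + 1) ≤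
      ∑ i ∈ Finset.range (k + 2), (a + c) ^ i * a ^ (k + 2 - 1 - i) := by
    refine le_of_mul_le_mul_left ?_ hc
    linarith
  have h2 : ((k : ℝ) + 2) ^ (k + 1) * (((k : ℝ) + 2) ^ 2 * a ^ (k + 1)) ≤
      a ^ (k + 1) * (((k : ℝ) + 3) ^ (k + 2) - (k + 2) ^ (k + 2)) :=
    (mul_le_mul_of_nonneg_left h1 (by positivity)).trans hsum
  have h3 : a ^ (k + 1) * (((k : ℝ) + 3) ^ (k + 2) - (k + 2) ^ (k + 2)) <
      a ^ (k + 1) * (((k : ℝ) + 2) * (k + 2) ^ (k + 2)) := by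
    refine mul_lt_mul_of_pos_left ?_ (by positivity)
    linarith
  have h4 : a ^ (k + 1) * (((k : ℝ) + 2) * (k + 2) ^ (k + 2)) =
    ((k : ℝ) + 2) ^ (k + 1) * (((k : ℝ) + 2) ^ 2 * a ^ (k + 1)) := by ring
  linarith

/-- A path with three positive parts at the beginning, for which the size of the third part is
large enough, is never a local maximum of the product. -/
theorem false_of_isLocalMax_threePart (k : ℕ) {a b c : ℝ} (ha : 0 < a) (hb : 0 < b) (hc : 0 < c)
    {f f₁ f₂ h h₁ h₂ : ℝ → ℝ}
    (hf₁ : ∀ x, HasDerivAt f (f₁ x) x) (hf₂ : ∀ x, HasDerivAt f₁ (f₂ x) x)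
    (hh₁ : ∀ x, HasDerivAt h (h₁ x) x) (hh₂ : ∀ x, HasDerivAt h₁ (h₂ x) x)
    (hf : ∀ x, 0 ≤ x → 0 ≤ f x ∧ 0 ≤ f₂ x) (hh : ∀ x, 0 ≤ x → 0 ≤ h x ∧ 0 ≤ h₁ x ∧ 0 ≤ h₂ x)
    (hmax : ∀ α β γ : ℝ, α + β + γ = 0 → IsLocalMax (fun t =>
      threePart k f (a + t * α) (b + t * β) ((a + c) + t * (α + γ)) *
        threePart k h (b + t * β) (c + t * γ) (b + t * β)) 0)
    (hgap : threePart k f a b (a + c) * b ^ (k + 1) = (k + 2) * a ^ (k + 1) * threePart k h b c b →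
      ((k : ℝ) + 2) ^ 2 * a ^ (k + 1) * c ≤ (a + c) ^ (k + 2) - a ^ (k + 2)) : False := by
  set K := threePart k f a b (a + c) with hK
  set J := threePart k h b c b with hJ
  have hKpos : 0 < K := by
    have := (hf (a + c) (by positivity)).1
    rw [hK, threePart]; positivity
  have hJpos : 0 < J := by
    have := (hh b hb.le).1
    rw [hJ, threePart]; positivity
  have hk2 : (0 : ℝ) < (k : ℝ) + 2 := by positivity
  have hk3 : (0 : ℝ) < (k : ℝ) + 3 := by positivity
  -- First-order condition for moving mass from the third part to the first, which leaves `a + c`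
  -- fixed.
  have hbal : K * b ^ (k + 1) = (k + 2) * a ^ (k + 1) * J := by
    have hd := (hmax 1 0 (-1) (by norm_num)).hasDerivAt_eq_zero
      ((hasDerivAt_threePart k hf₁ a 1 b 0 (a + c) (1 + -1) 0).mul
        (hasDerivAt_threePart k hh₁ b 0 c (-1) b 0 0))
    simp only [zero_mul, add_zero, mul_zero, mul_one, add_neg_cancel, zero_add, mul_neg, neg_zero]
      at hd
    rw [← hK, ← hJ] at hd
    have : ((k : ℝ) + 3) * b * (K * b ^ (k + 1) - (k + 2) * a ^ (k + 1) * J) = 0 := by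
      linear_combination -hd
    have := (mul_eq_zero.1 this).resolve_left (by positivity)
    linarith
  have hgap' := hgap hbal
  have hac := lt_mul_of_pow_sub_pow k ha hc hgap'
  have hP : (k + 2) * a ^ (k + 1) ≤ (a + c) ^ (k + 1) := by
    have h1 : (k + 2) * a ^ (k + 1) * (a + c) ≤ (a + c) ^ (k + 1) * (a + c) := by
      have h2 : 0 ≤ a ^ (k + 1) * ((k + 1) * ((k + 2) * c - a)) := by
        have : 0 ≤ (k + 2) * c - a := by linarith
        positivity
      have h3 : (a + c) ^ (k + 1) * (a + c) = (a + c) ^ (k + 2) := by ring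
      have h4 : a ^ (k + 2) = a ^ (k + 1) * a := by ring
      rw [h3]; rw [h4] at hgap'
      nlinarith
    exact le_of_mul_le_mul_right h1 (by positivity)
  obtain ⟨hh1, hh2⟩ := (hh b hb.le).2
  -- The direction (α, b, γ) is tuned so that the second factor has derivative zero along it
  -- (`hJ1`). The mixed term of the second derivative of the product then disappears.
  set W := h₁ b / ((k + 3) * b ^ (k + 1)) with hW
  have hW0 : 0 ≤ W := by positivity
  have hWb : h₁ b = W * ((k + 3) * b ^ (k + 1)) := by
    rw [hW]; field_simp
  set α := (k + 2) * c + W with hα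
  have hα0 : 0 < α := by positivity
  set γ := -(α + b) with hγ
  have hπ : α + γ = -b := by rw [hγ]; ring
  have hsecond := (hmax α b γ (by rw [hγ]; ring)).hasDerivAt_hasDerivAt_nonpos
    (fun t => (hasDerivAt_threePart k hf₁ a α b b (a + c) (α + γ) t).mul
        (hasDerivAt_threePart k hh₁ b b c γ b b t))
    (((hasDerivAt_deriv_threePart k hf₂ a α b b (a + c) (α + γ) 0).mul
      (hasDerivAt_threePart k hh₁ b b c γ b b 0)).add
      ((hasDerivAt_threePart k hf₁ a α b b (a + c) (α + γ) 0).mul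
        (hasDerivAt_deriv_threePart k hh₂ b b c γ b b 0)))
  simp only [zero_mul, add_zero] at hsecond
  rw [← hK, ← hJ, hπ, hWb] at hsecond
  have hJ1 : ((k : ℝ) + 3) * ((k + 2) * b ^ (k + 1) * b * c + b ^ (k + 2) * γ) +
      (k + 3) * b ^ (k + 2) * b + W * ((k + 3) * b ^ (k + 1)) * b = 0 := by
    rw [hγ, hα]; ring
  rw [hJ1] at hsecond
  have hf2 : 0 ≤ f₂ (a + c) := (hf (a + c) (by positivity)).2
  have e1 : 0 ≤ f₂ (a + c) * (-b) ^ 2 * J := by positivity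
  have e2 : 0 ≤ K * (h₂ b * b ^ 2) := by positivity
  have hpos : 0 < ((k : ℝ) + 1) * a ^ k * ((k + 2) * c * ((k + 2) * c - a) +
      2 * W * ((k + 2) * c - a) + W ^ 2) + b * ((a + c) ^ (k + 1) - (k + 2) * a ^ (k + 1)) := by
    have h1 : 0 < (k + 2) * c - a := by linarith
    have h2 : 0 ≤ (a + c) ^ (k + 1) - (k + 2) * a ^ (k + 1) := by linarith
    positivity
  have hpos' := mul_pos (mul_pos (mul_pos hk3 hk2) (mul_pos hJpos hb)) hpos
  -- Without the nonnegative `f₂` and `h₂` terms, the balance condition turns the second derivative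
  -- into a positive multiple of the expression in `hpos`.
  have key : (((k : ℝ) + 3) * ((k + 2) * (k + 1) * a ^ k * α ^ 2 * b +
        2 * (k + 2) * a ^ (k + 1) * α * b) +
        (k + 3) * (k + 2) * (a + c) ^ (k + 1) * (-b) ^ 2) * J +
      K * ((k + 3) * ((k + 2) * (k + 1) * b ^ k * b ^ 2 * c +
        2 * (k + 2) * b ^ (k + 1) * b * γ) + (k + 3) * (k + 2) * b ^ (k + 1) * b ^ 2) =
      (k + 3) * (k + 2) * (J * b) * (((k : ℝ) + 1) * a ^ k * ((k + 2) * c * ((k + 2) * c - a) +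
      2 * W * ((k + 2) * c - a) + W ^ 2) +
        b * ((a + c) ^ (k + 1) - (k + 2) * a ^ (k + 1))) := by
    rw [hγ, hα]
    linear_combination ((k : ℝ) + 3) * (k + 2) * b * ((k + 1) * c - 2 * ((k + 2) * c + W) - b) * hbal
  linarith

/-! ### Two parts maximise the product. -/

/-- The product whose maximum over paths of total length one is `gammaConst r`. -/
def pathProduct (r : ℕ) (L : List ℝ) : ℝ := pathSum r true L 0 * pathSum r false L 0

/-- Both factors have the shape `threePart`: in the complementary path the first part is independent
with nothing before it, so it contributes 0. Writing r = k + 3 avoids truncated exponents. -/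
theorem pathSum_true_three (k : ℕ) (a b c : ℝ) (R : List ℝ) :
    pathSum (k + 3) true (a :: b :: c :: R) 0 =
      threePart k (pathSum (k + 3) false R) a b (a + c) := by
  simp [pathSum, threePart]; ring

theorem pathSum_false_three (k : ℕ) (a b c : ℝ) (R : List ℝ) :
    pathSum (k + 3) false (a :: b :: c :: R) 0 =
      threePart k (pathSum (k + 3) true R) b c b := by
  simp [pathSum, threePart]; ring

theorem eventually_pos_affine {a : ℝ} (ha : 0 < a) (α : ℝ) : ∀ᶠ t : ℝ in 𝓝 0, 0 < a + t * α := by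
  have h : Tendsto (fun t : ℝ => a + t * α) (𝓝 0) (𝓝 (a + 0 * α)) :=
    (by fun_prop : Continuous fun t : ℝ => a + t * α).tendsto 0
  rw [zero_mul, add_zero] at h
  exact h.eventually (lt_mem_nhds ha)

theorem false_of_forall_pathProduct_le (k : ℕ) {a b c : ℝ} {R : List ℝ} (ha : 0 < a) (hb : 0 < b)
    (hc : 0 < c) (hR : ∀ l ∈ R, 0 < l)
    (hmax : ∀ L : List ℝ, L.length = (a :: b :: c :: R).length → (∀ l ∈ L, 0 ≤ l) →
      L.sum = (a :: b :: c :: R).sum →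
        pathProduct (k + 3) L ≤ pathProduct (k + 3) (a :: b :: c :: R)) : False := by
  have hR' : ∀ l ∈ R, 0 ≤ l := fun l hl => (hR l hl).le
  obtain ⟨f₁, f₂, hf₁, hf₂, hf₃⟩ := exists_deriv_pathSum (k + 3) false R hR'
  obtain ⟨h₁, h₂, hh₁, hh₂, hh₃⟩ := exists_deriv_pathSum (k + 3) true R hR'
  have hloc : ∀ α β γ : ℝ, α + β + γ = 0 → IsLocalMax (fun t =>
      threePart k (pathSum (k + 3) false R) (a + t * α) (b + t * β) ((a + c) + t * (α + γ)) *
        threePart k (pathSum (k + 3) true R) (b + t * β) (c + t * γ) (b + t * β)) 0 := by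
    intro α β γ hsum
    filter_upwards [eventually_pos_affine ha α, eventually_pos_affine hb β,
      eventually_pos_affine hc γ] with t h1 h2 h3
    have := hmax ((a + t * α) :: (b + t * β) :: (c + t * γ) :: R) (by simp)
      (by simpa using ⟨h1.le, h2.le, h3.le, hR'⟩)
      (by simp only [List.sum_cons]; linear_combination t * hsum)
    rw [pathProduct, pathProduct, pathSum_true_three, pathSum_true_three, pathSum_false_three,
      pathSum_false_three] at this
    simp only [zero_mul, add_zero]
    rw [show a + c + t * (α + γ) = a + t * α + (c + t * γ) by ring]
    exact this
  refine false_of_isLocalMax_threePart k ha hb hc hf₁ hf₂ hh₁ hh₂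
    (fun x hx => ⟨pathSum_nonneg _ _ _ hR' hx, (hf₃ x hx).2⟩)
    (fun x hx => ⟨pathSum_nonneg _ _ _ hR' hx, hh₃ x hx⟩) hloc fun hbal => ?_
  -- First-order condition for enlarging the second part; with the balance condition it gives the
  -- required gap, as an equality. The mass comes from the third part if there is no fourth,
  -- otherwise from the fourth.
  suffices h : ((a + c) ^ (k + 2) - a ^ (k + 2)) * threePart k (pathSum (k + 3) true R) b c b =
      threePart k (pathSum (k + 3) false R) a b (a + c) * ((k + 2) * b ^ (k + 1) * c) by
    have hJ : 0 < threePart k (pathSum (k + 3) true R) b c b := by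
      have := pathSum_nonneg (k + 3) true R hR' hb.le
      rw [threePart]; positivity
    refine le_of_mul_le_mul_right (le_of_eq ?_) hJ
    linear_combination -h - ((k : ℝ) + 2) * c * hbal
  have hk3 : (k : ℝ) + 3 ≠ 0 := by positivity
  cases R with
  | nil =>
    have hz : ∀ s, ∀ x, HasDerivAt (pathSum (k + 3) s []) ((fun _ => (0 : ℝ)) x) x := by
      intro s x
      have : pathSum (k + 3) s [] = fun _ => 0 := funext fun x => pathSum_nil _ s x
      rw [this]; exact hasDerivAt_const x 0
    have hd := (hloc 0 1 (-1) (by norm_num)).hasDerivAt_eq_zero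
      ((hasDerivAt_threePart k (hz false) a 0 b 1 (a + c) (0 + -1) 0).mul
        (hasDerivAt_threePart k (hz true) b 1 c (-1) b 1 0))
    simp only [zero_mul, add_zero, mul_zero, mul_one, zero_add] at hd
    refine mul_left_cancel₀ hk3 ?_
    linear_combination -hd
  | cons d R =>
    have hd : 0 < d := hR d (by simp)
    -- Parts two and four have the same type, so `b + d` is fixed and everything beyond them is
    -- constant in t.
    have hloc' : IsLocalMax (fun t =>
        ((k + 3) * (a ^ (k + 2) * (b + t * 1)) + (a + c) ^ (k + 3) +
          ((k + 3) * (a + c) ^ (k + 2) * (d + t * (-1)) + pathSum (k + 3) true R (a + c))) *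
        ((k + 3) * ((b + t * 1) ^ (k + 2) * c) +
          ((b + d) ^ (k + 3) + pathSum (k + 3) false R (b + d)))) 0 := by
      filter_upwards [eventually_pos_affine hb 1, eventually_pos_affine hd (-1)] with t h1 h2
      have hR2 : ∀ l ∈ R, 0 ≤ l := fun l hl => hR' l (by simp [hl])
      have := hmax (a :: (b + t * 1) :: c :: (d + t * (-1)) :: R) (by simp)
        (by simpa using ⟨ha.le, by simpa using h1.le, hc.le, by simpa using h2.le, hR2⟩)
        (by simp only [List.sum_cons]; ring)
      rw [pathProduct, pathProduct, pathSum_true_three, pathSum_true_three, pathSum_false_three,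
        pathSum_false_three] at this
      simp only [threePart, pathSum_true_cons, pathSum_false_cons] at this
      have e : b + t * 1 + (d + t * (-1)) = b + d := by ring
      rw [e] at this
      rw [show k + 3 - 1 = k + 2 from rfl] at this
      push_cast at this
      simp only [zero_mul, add_zero]
      refine le_of_eq_of_le ?_ (this.trans_eq ?_) <;> ring
    have hlin : ∀ x α : ℝ, HasDerivAt (fun t : ℝ => x + t * α) α 0 := fun x α => by
      simpa using ((hasDerivAt_id (0 : ℝ)).mul_const α).const_add x
    have h0 := hloc'.hasDerivAt_eq_zero
      ((((((hlin b 1).const_mul (a ^ (k + 2))).const_mul ((k : ℝ) + 3)).add_const _).add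
        (((hlin d (-1)).const_mul (((k : ℝ) + 3) * (a + c) ^ (k + 2))).add_const _)).mul
        ((((hasDerivAt_affine_pow (k + 1) b 1 0).mul_const c).const_mul ((k : ℝ) + 3)).add_const _))
    simp only [Pi.add_apply, zero_mul, add_zero, mul_one] at h0
    simp only [threePart, pathSum_true_cons, pathSum_false_cons]
    rw [show k + 3 - 1 = k + 2 from rfl]
    push_cast at h0 ⊢
    refine mul_left_cancel₀ hk3 ?_
    linear_combination -h0

theorem gammaFun_le_gammaConst (r : ℕ) {q : ℝ} (hq : q ∈ Set.Icc (0 : ℝ) 1) :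
    gammaFun r q ≤ gammaConst r :=
  (gammaConst_isGreatest r).2 ⟨q, hq, rfl⟩

theorem gammaConst_nonneg (r : ℕ) : 0 ≤ gammaConst r := by
  refine le_trans ?_ (gammaFun_le_gammaConst r (q := 1) ⟨zero_le_one, le_rfl⟩)
  simp only [gammaFun, sub_self, one_pow]; positivity

/-- A leading zero swaps the two factors, a trailing zero adds nothing, and an interior zero merges
its neighbours, which have the same type. -/
theorem pathProduct_eq_of_zero_mem (r : ℕ) (L : List ℝ) (hL : ∀ l ∈ L, 0 ≤ l) (h0 : (0 : ℝ) ∈ L) :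
    ∃ L' : List ℝ, L'.length < L.length ∧ (∀ l ∈ L', 0 ≤ l) ∧ L'.sum = L.sum ∧
      pathProduct r L' = pathProduct r L := by
  obtain ⟨L₁, L₂, rfl⟩ := List.append_of_mem h0
  rcases L₁.eq_nil_or_concat' with rfl | ⟨L₁, u, rfl⟩
  · refine ⟨L₂, by simp, fun l hl => hL l (by simp [hl]), by simp, ?_⟩
    simp [pathProduct, pathSum_zero_cons, mul_comm]
  rcases L₂ with _ | ⟨v, L₂⟩
  · refine ⟨L₁ ++ [u], by simp, fun l hl => hL l (List.mem_append_left _ hl), by simp, ?_⟩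
    simp only [pathProduct, pathSum_append_zero]
  · refine ⟨L₁ ++ (u + v) :: L₂, by simp, ?_, by simp; ring, ?_⟩
    · intro l hl
      rcases List.mem_append.1 hl with h | h
      · exact hL l (by simp [h])
      · rcases List.mem_cons.1 h with rfl | h
        · exact add_nonneg (hL u (by simp)) (hL v (by simp))
        · exact hL l (by simp [h])
    · simp only [pathProduct, List.append_assoc, List.cons_append, List.nil_append, pathSum_merge]

theorem exists_forall_pathProduct_le (r N : ℕ) (hN : 0 < N) :
    ∃ L : List ℝ, L.length = N ∧ (∀ l ∈ L, 0 ≤ l) ∧ L.sum = 1 ∧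
      ∀ L' : List ℝ, L'.length = N → (∀ l ∈ L', 0 ≤ l) → L'.sum = 1 →
        pathProduct r L' ≤ pathProduct r L := by
  have : Nonempty (Fin N) := ⟨⟨0, hN⟩⟩
  have hcont : Continuous fun z : Fin N → ℝ => pathProduct r (List.ofFn z) := by
    have h : ∀ s, Continuous fun z : Fin N → ℝ => pathSum r s (List.ofFn z) 0 := fun s =>
      (continuous_pathSum_ofFn r N s).comp (f := fun z : Fin N → ℝ => (z, (0 : ℝ))) (by fun_prop)
    exact (h true).mul (h false)
  have hne : (stdSimplex ℝ (Fin N)).Nonempty := ⟨_, single_mem_stdSimplex ℝ (⟨0, hN⟩ : Fin N)⟩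
  obtain ⟨z, hz, hmax⟩ := (isCompact_stdSimplex ℝ (Fin N)).exists_isMaxOn hne hcont.continuousOn
  refine ⟨List.ofFn z, by simp, ?_, by rw [List.sum_ofFn]; exact hz.2, ?_⟩
  · intro l hl
    obtain ⟨i, rfl⟩ := (List.mem_ofFn' _ _).1 hl
    exact hz.1 i
  · rintro L' rfl hL' hs
    have hm : L'.get ∈ stdSimplex ℝ (Fin L'.length) := by
      refine ⟨fun i => hL' _ (List.get_mem _ _), ?_⟩
      rw [← List.sum_ofFn, List.ofFn_get, hs]
    have := hmax hm
    simpa only [Set.mem_ofPred_eq, List.ofFn_get] using this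

/-- Among all continuous threshold graphs, two parts maximise the product of the densities. -/
theorem pathProduct_le_gammaConst (k N : ℕ) (L : List ℝ) (hlen : L.length = N)
    (hL : ∀ l ∈ L, 0 ≤ l) (hs : L.sum = 1) : pathProduct (k + 3) L ≤ gammaConst (k + 3) := by
  induction N using Nat.strong_induction_on generalizing L with
  | _ N ih =>
    rcases L with _ | ⟨p, _ | ⟨q, _ | ⟨c, L⟩⟩⟩
    · simp at hs
    · simpa [pathProduct, pathSum] using gammaConst_nonneg (k + 3)
    -- The first factor is p^r + r p^(r-1) q and the second is q^r, so the product is `gammaFun` at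
    -- q.
    · have hp : 0 ≤ p := hL p (by simp)
      have hq : 0 ≤ q := hL q (by simp)
      have hpq : p = 1 - q := by simp at hs; linarith
      refine le_trans (le_of_eq ?_) (gammaFun_le_gammaConst (k + 3) (q := q) ⟨hq, by linarith⟩)
      simp [pathProduct, pathSum, gammaFun, hpq]; ring
    · obtain ⟨M, hMlen, hM, hMs, hmax⟩ := exists_forall_pathProduct_le (k + 3) N
        (by rw [← hlen]; simp)
      refine (hmax _ hlen hL hs).trans ?_
      by_cases h0 : (0 : ℝ) ∈ M
      · obtain ⟨M', h1, h2, h3, h4⟩ := pathProduct_eq_of_zero_mem (k + 3) M hM h0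
        rw [← h4]
        exact ih _ (by omega) M' rfl h2 (h3.trans hMs)
      · exfalso
        have hpos : ∀ l ∈ M, 0 < l := fun l hl =>
          lt_of_le_of_ne (hM l hl) fun h => h0 (h ▸ hl)
        have hlen3 : 3 ≤ M.length := by
          rw [hMlen, ← hlen]; simp
        rcases M with _ | ⟨a, _ | ⟨b, _ | ⟨c, M⟩⟩⟩
        · simp at hlen3
        · simp at hlen3
        · simp at hlen3
        · refine false_of_forall_pathProduct_le k (hpos a (by simp)) (hpos b (by simp))
            (hpos c (by simp)) (fun l hl => hpos l (by simp [hl])) fun L' hl' hn' hs' =>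
            hmax L' (hl'.trans hMlen) hn' (hs'.trans hMs)

theorem pathProduct_le (k : ℕ) (L : List ℝ) (hL : ∀ l ∈ L, 0 ≤ l) :
    pathProduct (k + 3) L ≤ gammaConst (k + 3) * L.sum ^ (2 * (k + 3)) := by
  rcases (List.sum_nonneg hL).eq_or_lt with h | h
  · have hz : ∀ L : List ℝ, (∀ l ∈ L, 0 ≤ l) → L.sum = 0 → ∀ s, pathSum (k + 3) s L 0 = 0 := by
      intro L hL h s
      -- All entries vanish, so the list is its own multiple by 0 and homogeneity forces the sum to
      -- be 0.
      have h1 : L.map ((0 : ℝ) * ·) = L := by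
        conv_rhs => rw [← List.map_id L]
        refine List.map_congr_left fun l hl => ?_
        have := List.single_le_sum hL l hl
        simp only [zero_mul, id]
        exact le_antisymm (hL l hl) (by linarith)
      have := pathSum_scale (k + 3) (by omega) s L 0 0
      rw [h1] at this
      simpa using this
    rw [pathProduct, hz L hL h.symm, zero_mul]
    exact mul_nonneg (gammaConst_nonneg _) (by rw [← h]; positivity)
  · set S := L.sum with hS
    have h1 : (L.map (S⁻¹ * ·)).map (S * ·) = L := by
      rw [List.map_map]
      conv_rhs => rw [← List.map_id L]
      refine List.map_congr_left fun l _ => ?_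
      simp [h.ne']
    have h2 : ∀ s, pathSum (k + 3) s L 0 = S ^ (k + 3) * pathSum (k + 3) s (L.map (S⁻¹ * ·)) 0 := by
      intro s
      have := pathSum_scale (k + 3) (by omega) s (L.map (S⁻¹ * ·)) S 0
      rwa [h1, mul_zero] at this
    have h3 := pathProduct_le_gammaConst k _ (L.map (S⁻¹ * ·)) rfl
      (by
        intro l hl
        obtain ⟨x, hx, rfl⟩ := List.mem_map.1 hl
        exact mul_nonneg (by positivity) (hL x hx))
      (by rw [List.sum_map_mul_left, List.map_id', ← hS, inv_mul_cancel₀ h.ne'])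
    rw [pathProduct, h2, h2]
    rw [pathProduct] at h3
    calc _ = (pathSum (k + 3) true (L.map (S⁻¹ * ·)) 0 * pathSum (k + 3) false (L.map (S⁻¹ * ·)) 0)
          * S ^ (2 * (k + 3)) := by ring
      _ ≤ _ := by gcongr

/-! ### Shifting two families in opposite directions. -/

section Shifting

variable {α : Type*} [DecidableEq α]

/-- Re-indexing by the original family allows weights to be compared member by member. -/
theorem sum_uvCompression (u v : Finset α) (s : Finset (Finset α)) (φ : Finset α → ℕ) :
    ∑ a ∈ UV.compression u v s, φ a =
      ∑ a ∈ s, if UV.compress u v a ∈ s then φ a else φ (UV.compress u v a) := by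
  rw [UV.compression, Finset.sum_union, Finset.filter_image, Finset.sum_image UV.compress_injOn,
    Finset.sum_filter, Finset.sum_filter, ← Finset.sum_add_distrib]
  · refine Finset.sum_congr rfl fun a _ => ?_
    split_ifs <;> simp
  · exact UV.compress_disjoint

/-- A shift changes membership only at i and j, so only these two contributions need comparison. -/
theorem card_inter_eq_add (A B : Finset α) {i j : α} (hij : i ≠ j) :
    (A ∩ B).card = (((A ∩ B).erase i).erase j).card + (if i ∈ A ∧ i ∈ B then 1 else 0) +
      (if j ∈ A ∧ j ∈ B then 1 else 0) := by
  have h : ∀ (S : Finset α) (x : α), S.card = (S.erase x).card + if x ∈ S then 1 else 0 := by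
    intro S x
    split_ifs with hx
    · exact (Finset.card_erase_add_one hx).symm
    · rw [Finset.erase_eq_of_notMem hx, add_zero]
  rw [h (A ∩ B) i, h ((A ∩ B).erase i) j]
  simp only [Finset.mem_erase, Finset.mem_inter, ne_eq, hij.symm, not_false_eq_true, true_and]
  omega

theorem compress_singleton (i j : α) (A : Finset α) :
    UV.compress {i} {j} A = if i ∉ A ∧ j ∈ A then (A ∪ {i}) \ {j} else A := by
  simp [UV.compress]

theorem mem_compression_singleton {i j : α} {𝒜 : Finset (Finset α)} {A' : Finset α}
    (h : A' ∈ UV.compression {i} {j} 𝒜) :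
    (A' ∈ 𝒜 ∧ (i ∉ A' → j ∈ A' → (A' ∪ {i}) \ {j} ∈ 𝒜)) ∨
      ∃ A ∈ 𝒜, i ∉ A ∧ j ∈ A ∧ A' = (A ∪ {i}) \ {j} := by
  rw [UV.mem_compression] at h
  rcases h with ⟨h1, h2⟩ | ⟨h1, A, hA, h2⟩
  · refine Or.inl ⟨h1, fun hi hj => ?_⟩
    rwa [compress_singleton, if_pos ⟨hi, hj⟩] at h2
  · rw [compress_singleton] at h2
    split_ifs at h2 with hc
    · exact Or.inr ⟨A, hA, hc.1, hc.2, h2.symm⟩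
    · exact absurd (h2 ▸ hA) h1

/-- Shifting two families in opposite directions preserves bounds on the cross intersections. -/
theorem card_inter_le_of_mem_compression {i j : α} (hij : i ≠ j) {t : ℕ}
    {𝒜 ℬ : Finset (Finset α)} (h : ∀ A ∈ 𝒜, ∀ B ∈ ℬ, (A ∩ B).card ≤ t)
    {A B : Finset α} (hA : A ∈ UV.compression {i} {j} 𝒜) (hB : B ∈ UV.compression {j} {i} ℬ) :
    (A ∩ B).card ≤ t := by
  have hcore : ∀ A B A' B' : Finset α, (∀ x, x ≠ i → x ≠ j → (x ∈ A ↔ x ∈ A')) →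
      (∀ x, x ≠ i → x ≠ j → (x ∈ B ↔ x ∈ B')) →
      ((A ∩ B).erase i).erase j = ((A' ∩ B').erase i).erase j := by
    intro A B A' B' h1 h2
    ext x
    simp only [Finset.mem_erase, Finset.mem_inter]
    constructor
    · rintro ⟨hj, hi, ha, hb⟩
      exact ⟨hj, hi, (h1 x hi hj).1 ha, (h2 x hi hj).1 hb⟩
    · rintro ⟨hj, hi, ha, hb⟩
      exact ⟨hj, hi, (h1 x hi hj).2 ha, (h2 x hi hj).2 hb⟩
  have hsw : ∀ (A : Finset α) (i' j' x : α), x ≠ i' → x ≠ j' →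
      (x ∈ A ↔ x ∈ (A ∪ {i'}) \ {j'}) := by
    intro A i' j' x h1 h2
    simp [h1, h2]
  rcases mem_compression_singleton hA with ⟨hA1, hA2⟩ | ⟨A₀, hA1, hA2, hA3, rfl⟩
  · rcases mem_compression_singleton hB with ⟨hB1, -⟩ | ⟨B₀, hB1, hB2, hB3, rfl⟩
    · exact h A hA1 B hB1
    · have hc := hcore A ((B₀ ∪ {j}) \ {i}) A B₀ (fun _ _ _ => Iff.rfl)
        (fun x h1 h2 => (hsw B₀ j i x h2 h1).symm)
      rw [card_inter_eq_add _ _ hij, hc]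
      by_cases hj : j ∈ A
      · by_cases hi : i ∈ A
        · have := h A hA1 B₀ hB1
          rw [card_inter_eq_add _ _ hij] at this
          simpa [hi, hj, hij, hij.symm, hB2, hB3] using this
        -- Since `A` stayed in place, its shift is in 𝒜 too. That shift meets `B₀` at i, just as `A`
        -- meets the shifted `B₀` at j.
        · have := h _ (hA2 hi hj) B₀ hB1
          have hc' := hcore ((A ∪ {i}) \ {j}) B₀ A B₀ (fun x h1 h2 => (hsw A i j x h1 h2).symm)
            (fun _ _ _ => Iff.rfl)
          rw [card_inter_eq_add _ _ hij, hc'] at this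
          simpa [hi, hj, hij, hij.symm, hB2, hB3] using this
      · have := h A hA1 B₀ hB1
        rw [card_inter_eq_add _ _ hij] at this
        have h2 : (((A ∩ B₀).erase i).erase j).card ≤ t := by omega
        simpa [hj, hij, hij.symm, hB2, hB3] using h2
  · rcases mem_compression_singleton hB with ⟨hB1, hB2⟩ | ⟨B₀, hB1, hB2, hB3, rfl⟩
    · have hc := hcore ((A₀ ∪ {i}) \ {j}) B A₀ B (fun x h1 h2 => (hsw A₀ i j x h1 h2).symm)
        (fun _ _ _ => Iff.rfl)
      rw [card_inter_eq_add _ _ hij, hc]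
      by_cases hi : i ∈ B
      · by_cases hj : j ∈ B
        · have := h A₀ hA1 B hB1
          rw [card_inter_eq_add _ _ hij] at this
          simpa [hi, hj, hij, hij.symm, hA2, hA3] using this
        · have := h A₀ hA1 _ (hB2 hj hi)
          have hc' := hcore A₀ ((B ∪ {j}) \ {i}) A₀ B (fun _ _ _ => Iff.rfl)
            (fun x h1 h2 => (hsw B j i x h2 h1).symm)
          rw [card_inter_eq_add _ _ hij, hc'] at this
          simpa [hi, hj, hij, hij.symm, hA2, hA3] using this
      · have := h A₀ hA1 B hB1
        rw [card_inter_eq_add _ _ hij] at this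
        have h2 : (((A₀ ∩ B).erase i).erase j).card ≤ t := by omega
        simpa [hi, hij, hij.symm, hA2, hA3] using h2
    -- Both sets have moved: i lies only in the first and j only in the second, so neither point is
    -- common.
    · have hc := hcore ((A₀ ∪ {i}) \ {j}) ((B₀ ∪ {j}) \ {i}) A₀ B₀
        (fun x h1 h2 => (hsw A₀ i j x h1 h2).symm) (fun x h1 h2 => (hsw B₀ j i x h2 h1).symm)
      have := h A₀ hA1 B₀ hB1
      rw [card_inter_eq_add _ _ hij] at this
      rw [card_inter_eq_add _ _ hij, hc]
      have h2 : (((A₀ ∩ B₀).erase i).erase j).card ≤ t := by omega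
      simpa [hij, hij.symm] using h2

/-- If every effective shift lowers a weight, then shifting does not raise the total weight, and
lowers it unless the family is already shifted. -/
theorem sum_uvCompression_lt {i j : α} (s : Finset (Finset α)) (φ : Finset α → ℕ)
    (hφ : ∀ A : Finset α, i ∉ A → j ∈ A → φ ((A ∪ {i}) \ {j}) < φ A) :
    ∑ a ∈ UV.compression {i} {j} s, φ a ≤ ∑ a ∈ s, φ a ∧
      ((∃ A ∈ s, i ∉ A ∧ j ∈ A ∧ (A ∪ {i}) \ {j} ∉ s) →
        ∑ a ∈ UV.compression {i} {j} s, φ a < ∑ a ∈ s, φ a) := by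
  rw [sum_uvCompression]
  have hle : ∀ A ∈ s, (if UV.compress {i} {j} A ∈ s then φ A else φ (UV.compress {i} {j} A)) ≤
      φ A := by
    intro A hA
    split_ifs with h1
    · exact le_rfl
    · rw [compress_singleton] at h1 ⊢
      split_ifs at h1 ⊢ with h2
      · exact (hφ A h2.1 h2.2).le
      · exact absurd hA h1
  refine ⟨Finset.sum_le_sum hle, ?_⟩
  rintro ⟨A, hA, hi, hj, hn⟩
  refine Finset.sum_lt_sum hle ⟨A, hA, ?_⟩
  have : UV.compress {i} {j} A = (A ∪ {i}) \ {j} := by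
    rw [compress_singleton, if_pos ⟨hi, hj⟩]
  rw [this, if_neg hn]
  exact hφ A hi hj

theorem sum_union_sdiff_singleton_lt {w : α → ℕ} {i j : α} (hw : w i < w j) (A : Finset α)
    (hi : i ∉ A) (hj : j ∈ A) : ∑ x ∈ (A ∪ {i}) \ {j}, w x < ∑ x ∈ A, w x := by
  have hij : i ≠ j := fun h => hi (h ▸ hj)
  have e : (A ∪ {i}) \ {j} = insert i (A.erase j) := by
    ext x
    by_cases hx : x = i
    · subst hx; simp [hij]
    · simp [hx, and_comm]
  rw [e, Finset.sum_insert (by simp [hi]), ← Finset.add_sum_erase A w hj]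
  omega

end Shifting

/-- Every pair of families with small cross intersections can be shifted: the first family to the
left, the second one to the right. -/
theorem exists_shifted {n r t : ℕ} (𝒜 ℬ : Finset (Finset (Fin n)))
    (h𝒜 : (𝒜 : Set (Finset (Fin n))).Sized r) (hℬ : (ℬ : Set (Finset (Fin n))).Sized r)
    (h : ∀ A ∈ 𝒜, ∀ B ∈ ℬ, (A ∩ B).card ≤ t) :
    ∃ 𝒜' ℬ' : Finset (Finset (Fin n)), 𝒜'.card = 𝒜.card ∧ ℬ'.card = ℬ.card ∧
      (𝒜' : Set (Finset (Fin n))).Sized r ∧ (ℬ' : Set (Finset (Fin n))).Sized r ∧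
      (∀ A ∈ 𝒜', ∀ B ∈ ℬ', (A ∩ B).card ≤ t) ∧
      (∀ i j : Fin n, i < j → ∀ A ∈ 𝒜', i ∉ A → j ∈ A → (A ∪ {i}) \ {j} ∈ 𝒜') ∧
      (∀ i j : Fin n, i < j → ∀ B ∈ ℬ', j ∉ B → i ∈ B → (B ∪ {j}) \ {i} ∈ ℬ') := by
  -- Potential for termination: points of 𝒜 weigh their position, points of ℬ their distance from
  -- the right end. Every effective shift lowers it.
  generalize hN : (∑ A ∈ 𝒜, ∑ x ∈ A, (x : ℕ)) + ∑ B ∈ ℬ, ∑ x ∈ B, (n - (x : ℕ)) = N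
  induction N using Nat.strong_induction_on generalizing 𝒜 ℬ with
  | _ N ih =>
    by_cases hst : (∀ i j : Fin n, i < j → ∀ A ∈ 𝒜, i ∉ A → j ∈ A → (A ∪ {i}) \ {j} ∈ 𝒜) ∧
      (∀ i j : Fin n, i < j → ∀ B ∈ ℬ, j ∉ B → i ∈ B → (B ∪ {j}) \ {i} ∈ ℬ)
    · exact ⟨𝒜, ℬ, rfl, rfl, h𝒜, hℬ, h, hst.1, hst.2⟩
    · have key : ∀ i j : Fin n, i < j →
          ((∃ A ∈ 𝒜, i ∉ A ∧ j ∈ A ∧ (A ∪ {i}) \ {j} ∉ 𝒜) ∨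
            ∃ B ∈ ℬ, j ∉ B ∧ i ∈ B ∧ (B ∪ {j}) \ {i} ∉ ℬ) →
          (∑ A ∈ UV.compression {i} {j} 𝒜, ∑ x ∈ A, (x : ℕ)) +
            ∑ B ∈ UV.compression {j} {i} ℬ, ∑ x ∈ B, (n - (x : ℕ)) < N := by
        intro i j hij hor
        have h1 := sum_uvCompression_lt (i := i) (j := j) 𝒜 (fun A => ∑ x ∈ A, (x : ℕ))
          (sum_union_sdiff_singleton_lt (w := fun x : Fin n => (x : ℕ)) hij)
        have h2 := sum_uvCompression_lt (i := j) (j := i) ℬ (fun A => ∑ x ∈ A, (n - (x : ℕ)))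
          (sum_union_sdiff_singleton_lt (w := fun x : Fin n => n - (x : ℕ))
            (by have := j.2; have : (i : ℕ) < j := hij; omega))
        rcases hor with h3 | h3
        · have := h1.2 h3; have := h2.1; omega
        · have := h2.2 h3; have := h1.1; omega
      obtain ⟨i, j, hij, hor⟩ : ∃ i j : Fin n, i < j ∧
          ((∃ A ∈ 𝒜, i ∉ A ∧ j ∈ A ∧ (A ∪ {i}) \ {j} ∉ 𝒜) ∨
            ∃ B ∈ ℬ, j ∉ B ∧ i ∈ B ∧ (B ∪ {j}) \ {i} ∉ ℬ) := by
        rw [not_and_or] at hst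
        rcases hst with hst | hst
        · push Not at hst
          obtain ⟨i, j, hij, A, h1, h2, h3, h4⟩ := hst
          exact ⟨i, j, hij, Or.inl ⟨A, h1, h2, h3, h4⟩⟩
        · push Not at hst
          obtain ⟨i, j, hij, A, h1, h2, h3, h4⟩ := hst
          exact ⟨i, j, hij, Or.inr ⟨A, h1, h2, h3, h4⟩⟩
      obtain ⟨𝒜', ℬ', e1, e2, e3⟩ := ih _ (key i j hij hor) (UV.compression {i} {j} 𝒜)
        (UV.compression {j} {i} ℬ) (h𝒜.uvCompression (by simp)) (hℬ.uvCompression (by simp))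
        (fun A hA B hB => card_inter_le_of_mem_compression hij.ne h hA hB) rfl
      rw [UV.card_compression] at e1 e2
      exact ⟨𝒜', ℬ', e1, e2, e3⟩

/-! ### Peeling extreme vertices off shifted families. -/

section Peeling

variable {n : ℕ}

/-- The members of `𝒜` inside `D ∪ J` that meet `J`. -/
def spanning (𝒜 : Finset (Finset (Fin n))) (D J : Finset (Fin n)) : Finset (Finset (Fin n)) :=
  𝒜.filter fun A => A ⊆ D ∪ J ∧ ¬ Disjoint A J

theorem card_filter_erase_subset_le {m : ℕ} {𝒜 : Finset (Finset (Fin n))}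
    (h𝒜 : (𝒜 : Set (Finset (Fin n))).Sized (m + 1)) (D : Finset (Fin n)) (v : Fin n) :
    (𝒜.filter fun A => v ∈ A ∧ A.erase v ⊆ D).card ≤ D.card.choose m := by
  rw [← Finset.card_powersetCard]
  refine Finset.card_le_card_of_injOn (fun A => A.erase v) ?_ ?_
  · intro A hA
    have hA' := Finset.mem_filter.1 hA
    refine Finset.mem_powersetCard.2 ⟨hA'.2.2, ?_⟩
    rw [Finset.card_erase_of_mem hA'.2.1, h𝒜 hA'.1, Nat.add_sub_cancel]
  · intro A hA B hB hAB
    have hA' := Finset.mem_filter.1 hA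
    have hB' := Finset.mem_filter.1 hB
    rw [← Finset.insert_erase hA'.2.1, ← Finset.insert_erase hB'.2.1]
    exact congrArg (insert v) hAB

/-- A counted member disjoint from `J` contains `v` and otherwise lies in `D`; the remaining ones
are still counted once `v` has moved into `D`. -/
theorem card_spanning_insert_le {m : ℕ} {𝒜 : Finset (Finset (Fin n))}
    (h𝒜 : (𝒜 : Set (Finset (Fin n))).Sized (m + 1)) (D J : Finset (Fin n)) (v : Fin n) :
    (spanning 𝒜 D (insert v J)).card ≤
      D.card.choose m + (spanning 𝒜 (insert v D) J).card := by
  refine (Finset.card_le_card (t := (𝒜.filter fun A => v ∈ A ∧ A.erase v ⊆ D) ∪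
    spanning 𝒜 (insert v D) J) ?_).trans ((Finset.card_union_le _ _).trans
      (Nat.add_le_add_right (card_filter_erase_subset_le h𝒜 D v) _))
  intro A hA
  simp only [spanning, Finset.mem_filter, Finset.mem_union] at hA ⊢
  obtain ⟨hA, hs, hd⟩ := hA
  by_cases hJ : Disjoint A J
  · left
    have hsD : ∀ x ∈ A, x ≠ v → x ∈ D := by
      intro x hx hxv
      have hxJ : x ∉ J := Finset.disjoint_left.1 hJ hx
      simpa [hxv, hxJ] using hs hx
    refine ⟨hA, ?_, fun x hx => hsD x (Finset.mem_erase.1 hx).2 (Finset.mem_erase.1 hx).1⟩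
    by_contra hv
    exact hd (Finset.disjoint_insert_right.2 ⟨hv, hJ⟩)
  · right
    refine ⟨hA, ?_, hJ⟩
    rwa [Finset.insert_union, ← Finset.union_insert]

/-- No member meeting `J` passes through an isolated `v`, so `v` need not enter `D`. -/
theorem card_spanning_insert_le_of_isolated {m : ℕ} {𝒜 : Finset (Finset (Fin n))}
    (h𝒜 : (𝒜 : Set (Finset (Fin n))).Sized (m + 1)) (D J : Finset (Fin n)) (v : Fin n)
    (hv : ∀ A ∈ 𝒜, v ∈ A → Disjoint A J) :
    (spanning 𝒜 D (insert v J)).card ≤ D.card.choose m + (spanning 𝒜 D J).card := by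
  refine (card_spanning_insert_le h𝒜 D J v).trans (Nat.add_le_add_left (Finset.card_le_card ?_) _)
  intro A hA
  simp only [spanning, Finset.mem_filter] at hA ⊢
  obtain ⟨hA, hs, hd⟩ := hA
  refine ⟨hA, fun x hx => ?_, hd⟩
  have hxv : x ≠ v := fun h => hd (hv A hA (h ▸ hx))
  simpa [hxv] using hs hx

/-- Together with `factorial_mul_choose_le`, this lets a clique part of length one absorb the
members lost with one peeled vertex. -/
theorem add_pow_sub_pow_ge (m : ℕ) {x : ℝ} (hx : 0 ≤ x) :
    ((m : ℝ) + 1) * x ^ m ≤ (x + 1) ^ (m + 1) - x ^ (m + 1) := by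
  induction m with
  | zero => simp
  | succ m ih =>
    have h1 := mul_le_mul_of_nonneg_right ih (by linarith : 0 ≤ x + 1)
    have h2 : 0 ≤ ((m : ℝ) + 1) * x ^ m := by positivity
    push_cast
    rw [pow_succ (x + 1) (m + 1)]
    have e1 : x ^ (m + 1 + 1) = x ^ (m + 1) * x := pow_succ _ _
    have e2 : x ^ (m + 1) = x ^ m * x := pow_succ _ _
    rw [e1]
    rw [e2] at h1 ⊢
    linarith

theorem factorial_mul_choose_le (m d : ℕ) {x : ℝ} (hd : (d : ℝ) ≤ x) :
    ((m + 1).factorial : ℝ) * (d.choose m : ℝ) ≤ (m + 1) * x ^ m := by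
  have h1 : (m.factorial : ℝ) * (d.choose m : ℝ) ≤ x ^ m := by
    have h : m.factorial * d.choose m ≤ d ^ m := by
      rw [← Nat.descFactorial_eq_factorial_mul_choose]; exact Nat.descFactorial_le_pow d m
    calc (m.factorial : ℝ) * (d.choose m : ℝ) ≤ (d : ℝ) ^ m := by exact_mod_cast h
      _ ≤ x ^ m := by gcongr
  rw [Nat.factorial_succ]
  push_cast
  rw [mul_assoc]
  gcongr

/-- The elements of `Fin n` with value in `[a, b)`. -/
def finInterval (n a b : ℕ) : Finset (Fin n) := Finset.univ.filter fun i => a ≤ (i : ℕ) ∧ (i : ℕ) < b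

theorem mem_finInterval {a b : ℕ} {i : Fin n} : i ∈ finInterval n a b ↔ a ≤ (i : ℕ) ∧ (i : ℕ) < b := by
  simp [finInterval]

/-- Peeling off the vertices of an interval one by one, always an extreme one that is isolated for
one of the two shifted families. -/
theorem exists_pathSum_ge {m : ℕ} {𝒜 ℬ : Finset (Finset (Fin n))}
    (h𝒜 : (𝒜 : Set (Finset (Fin n))).Sized (m + 1))
    (hℬ : (ℬ : Set (Finset (Fin n))).Sized (m + 1))
    (h : ∀ A ∈ 𝒜, ∀ B ∈ ℬ, (A ∩ B).card ≤ 1)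
    (hsA : ∀ i j : Fin n, i < j → ∀ A ∈ 𝒜, i ∉ A → j ∈ A → (A ∪ {i}) \ {j} ∈ 𝒜)
    (hsB : ∀ i j : Fin n, i < j → ∀ B ∈ ℬ, j ∉ B → i ∈ B → (B ∪ {j}) \ {i} ∈ ℬ)
    (d a : ℕ) (had : a + d ≤ n) (D E : Finset (Fin n)) (x y : ℝ) (hx : (D.card : ℝ) ≤ x)
    (hy : (E.card : ℝ) ≤ y) :
    ∃ L : List ℝ, (∀ l ∈ L, 0 ≤ l) ∧ L.sum = d ∧
      ((m + 1).factorial : ℝ) * (spanning 𝒜 D (finInterval n a (a + d))).card ≤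
        pathSum (m + 1) true L x ∧
      ((m + 1).factorial : ℝ) * (spanning ℬ E (finInterval n a (a + d))).card ≤
        pathSum (m + 1) false L y := by
  induction d generalizing a D E x y with
  | zero =>
    have hJ : finInterval n a (a + 0) = ∅ := by
      ext i; simp only [mem_finInterval, Finset.notMem_empty, iff_false]; omega
    refine ⟨[], by simp, by simp, ?_, ?_⟩ <;> rw [hJ] <;> simp [spanning, pathSum_nil]
  | succ d ih =>
    have hx0 : 0 ≤ x := le_trans (by positivity) hx
    have hy0 : 0 ≤ y := le_trans (by positivity) hy
    set lo : Fin n := ⟨a, by omega⟩ with hlo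
    set hi : Fin n := ⟨a + d, by omega⟩ with hhi
    -- Requiring `lo ≠ hi` sends a one-point interval to the second case, where isolation is
    -- vacuous.
    by_cases hG : ∃ A ∈ 𝒜, lo ∈ A ∧ hi ∈ A ∧ lo ≠ hi
    · obtain ⟨A, hA, hAlo, hAhi, hne⟩ := hG
      have hd : 0 < d := by
        by_contra h0
        exact hne (Fin.ext (by simp [hlo, hhi]; omega))
      have hno : ∀ B ∈ ℬ, lo ∈ B → hi ∉ B := by
        intro B hB h1 h2
        have h3 := Finset.card_le_one.1 (h A hA B hB) lo (by simp [hAlo, h1]) hi (by simp [hAhi, h2])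
        exact hne h3
      have hJ : finInterval n a (a + (d + 1)) = insert lo (finInterval n (a + 1) (a + 1 + d)) := by
        ext i
        simp only [Finset.mem_insert, mem_finInterval, Fin.ext_iff, hlo]
        omega
      have hiso : ∀ B ∈ ℬ, lo ∈ B → Disjoint B (finInterval n (a + 1) (a + 1 + d)) := by
        intro B hB hBlo
        rw [Finset.disjoint_left]
        intro u hu huJ
        rw [mem_finInterval] at huJ
        have hBhi := hno B hB hBlo
        have hulo : lo ≠ u := fun hh => by
          have := congrArg Fin.val hh; simp only [hlo] at this; omega
        have hult : u < hi := by
          refine lt_of_le_of_ne (Fin.le_def.2 (by simp only [hhi]; omega)) fun hh => hBhi (hh ▸ hu)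
        -- Shifting `u` to `hi` would give a member of ℬ containing both ends.
        refine hno _ (hsB u hi hult B hB hBhi hu) ?_ ?_
        · simp [hBlo, hulo]
        · simp [hult.ne']
      -- As `x` is only an upper bound for |D|, it is not necessary to track that `D` avoids the
      -- interval.
      obtain ⟨L, hL, hs, h1, h2⟩ := ih (a + 1) (by omega) (insert lo D) E (x + 1) y
        (by
          have : ((insert lo D).card : ℝ) ≤ D.card + 1 := by exact_mod_cast Finset.card_insert_le _ _
          linarith) hy
      -- The vertex `lo` becomes a unit part, clique for 𝒜 and independent for ℬ; the zero restores
      -- the flags for `L`.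
      refine ⟨1 :: 0 :: L, by simpa using hL, by simp [hs]; ring, ?_, ?_⟩
      · rw [hJ, pathSum_true_cons, pathSum_zero_cons]
        have h3 : ((spanning 𝒜 D (insert lo (finInterval n (a + 1) (a + 1 + d)))).card : ℝ) ≤
            D.card.choose m + (spanning 𝒜 (insert lo D) (finInterval n (a + 1) (a + 1 + d))).card := by
          exact_mod_cast card_spanning_insert_le h𝒜 _ _ _
        have h4 := mul_le_mul_of_nonneg_left h3
          (by positivity : (0 : ℝ) ≤ ((m + 1).factorial : ℝ))
        have h5 := factorial_mul_choose_le m D.card hx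
        have h6 := add_pow_sub_pow_ge m hx0
        simp only [Bool.not_false]
        linarith
      · rw [hJ, pathSum_false_cons, pathSum_zero_cons]
        have h3 : ((spanning ℬ E (insert lo (finInterval n (a + 1) (a + 1 + d)))).card : ℝ) ≤
            E.card.choose m + (spanning ℬ E (finInterval n (a + 1) (a + 1 + d))).card := by
          exact_mod_cast card_spanning_insert_le_of_isolated hℬ _ _ _ hiso
        have h4 := mul_le_mul_of_nonneg_left h3
          (by positivity : (0 : ℝ) ≤ ((m + 1).factorial : ℝ))
        have h5 := factorial_mul_choose_le m E.card hy
        simp only [Bool.not_true, Nat.add_sub_cancel]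
        push_cast
        linarith
    · have hno : ∀ A ∈ 𝒜, lo ≠ hi → hi ∈ A → lo ∉ A := by
        intro A hA hne h1 h2
        exact hG ⟨A, hA, h2, h1, hne⟩
      have hJ : finInterval n a (a + (d + 1)) = insert hi (finInterval n a (a + d)) := by
        ext i
        simp only [Finset.mem_insert, mem_finInterval, Fin.ext_iff, hhi]
        omega
      have hiso : ∀ A ∈ 𝒜, hi ∈ A → Disjoint A (finInterval n a (a + d)) := by
        intro A hA hAhi
        rw [Finset.disjoint_left]
        intro u hu huJ
        rw [mem_finInterval] at huJ
        have hne : lo ≠ hi := fun hh => by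
          have := congrArg Fin.val hh; simp only [hlo, hhi] at this; omega
        have hAlo := hno A hA hne hAhi
        have huhi : hi ≠ u := fun hh => by
          have := congrArg Fin.val hh; simp only [hhi] at this; omega
        have hult : lo < u := by
          refine lt_of_le_of_ne (Fin.le_def.2 (by simp only [hlo]; omega)) fun hh => hAlo (hh ▸ hu)
        refine hno _ (hsA lo u hult A hA hAlo hu) hne ?_ ?_
        · simp [hAhi, huhi]
        · simp [hult.ne]
      obtain ⟨L, hL, hs, h1, h2⟩ := ih a (by omega) D (insert hi E) x (y + 1) hx
        (by
          have : ((insert hi E).card : ℝ) ≤ E.card + 1 := by exact_mod_cast Finset.card_insert_le _ _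
          linarith)
      -- The leading zero swaps the types: the unit part of `hi` is independent for 𝒜 and clique for
      -- ℬ.
      refine ⟨0 :: 1 :: L, by simpa using hL, by simp [hs]; ring, ?_, ?_⟩
      · rw [hJ, pathSum_zero_cons, Bool.not_true, pathSum_false_cons]
        have h3 : ((spanning 𝒜 D (insert hi (finInterval n a (a + d)))).card : ℝ) ≤
            D.card.choose m + (spanning 𝒜 D (finInterval n a (a + d))).card := by
          exact_mod_cast card_spanning_insert_le_of_isolated h𝒜 _ _ _ hiso
        have h4 := mul_le_mul_of_nonneg_left h3
          (by positivity : (0 : ℝ) ≤ ((m + 1).factorial : ℝ))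
        have h5 := factorial_mul_choose_le m D.card hx
        simp only [Nat.add_sub_cancel]
        push_cast
        linarith
      · rw [hJ, pathSum_zero_cons, Bool.not_false, pathSum_true_cons]
        have h3 : ((spanning ℬ E (insert hi (finInterval n a (a + d)))).card : ℝ) ≤
            E.card.choose m + (spanning ℬ (insert hi E) (finInterval n a (a + d))).card := by
          exact_mod_cast card_spanning_insert_le hℬ _ _ _
        have h4 := mul_le_mul_of_nonneg_left h3
          (by positivity : (0 : ℝ) ≤ ((m + 1).factorial : ℝ))
        have h5 := factorial_mul_choose_le m E.card hy
        have h6 := add_pow_sub_pow_ge m hy0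
        linarith

end Peeling

/-- Two `r`-uniform families whose members meet pairwise in at most one point. -/
theorem card_mul_card_le_of_card_inter_le_one {n r : ℕ} (hr : 3 ≤ r)
    {𝒜 ℬ : Finset (Finset (Fin n))} (h𝒜 : (𝒜 : Set (Finset (Fin n))).Sized r)
    (hℬ : (ℬ : Set (Finset (Fin n))).Sized r) (h : ∀ A ∈ 𝒜, ∀ B ∈ ℬ, (A ∩ B).card ≤ 1) :
    (r.factorial : ℝ) ^ 2 * ((𝒜.card : ℝ) * ℬ.card) ≤ gammaConst r * (n : ℝ) ^ (2 * r) := by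
  obtain ⟨k, rfl⟩ := Nat.exists_eq_add_of_le' hr
  obtain ⟨𝒜', ℬ', e1, e2, s1, s2, hc, hA, hB⟩ := exists_shifted 𝒜 ℬ h𝒜 hℬ h
  obtain ⟨L, hL, hs, h1, h2⟩ := exists_pathSum_ge (m := k + 2) s1 s2 hc hA hB n 0 (by simp) ∅ ∅ 0 0
    (by simp) (by simp)
  have hspan : ∀ 𝒞 : Finset (Finset (Fin n)), (𝒞 : Set (Finset (Fin n))).Sized (k + 3) →
      spanning 𝒞 ∅ (finInterval n 0 (0 + n)) = 𝒞 := by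
    intro 𝒞 h𝒞
    have hJ : finInterval n 0 (0 + n) = Finset.univ := by
      ext i; simp [mem_finInterval]
    rw [spanning, Finset.filter_true_of_mem]
    intro A hA
    rw [hJ]
    refine ⟨by simp, ?_⟩
    have : A ≠ ∅ := by
      rintro rfl
      have := h𝒞 hA
      simp at this
    simpa [← Finset.top_eq_univ] using this
  rw [hspan _ s1, e1] at h1
  rw [hspan _ s2, e2] at h2
  have h3 := pathProduct_le k L hL
  rw [pathProduct, hs] at h3
  refine le_trans ?_ h3
  calc ((k + 3).factorial : ℝ) ^ 2 * ((𝒜.card : ℝ) * ℬ.card)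
      = ((k + 3).factorial * (𝒜.card : ℝ)) * ((k + 3).factorial * ℬ.card) := by ring
    _ ≤ _ := mul_le_mul h1 h2 (by positivity) (pathSum_nonneg _ _ _ hL le_rfl)

/-! ### Reduction to small intersections, disjoint pairs, and star families. -/

section Counting

variable {n r : ℕ}

theorem card_le_choose_of_sized {𝒜 : Finset (Finset (Fin n))}
    (h𝒜 : (𝒜 : Set (Finset (Fin n))).Sized r) : 𝒜.card ≤ n.choose r := by
  simpa using h𝒜.card_le

theorem card_filter_superset_le {𝒜 : Finset (Finset (Fin n))}
    (h𝒜 : (𝒜 : Set (Finset (Fin n))).Sized r) (Q : Finset (Fin n)) :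
    (𝒜.filter fun A => Q ⊆ A).card ≤ n ^ (r - Q.card) := by
  refine le_trans ?_ (Nat.choose_le_pow n (r - Q.card))
  have : n.choose (r - Q.card) = (Finset.powersetCard (r - Q.card) (Finset.univ : Finset (Fin n))).card := by
    simp
  rw [this]
  refine Finset.card_le_card_of_injOn (fun A => A \ Q) ?_ ?_
  · intro A hA
    have hA' := Finset.mem_filter.1 hA
    refine Finset.mem_powersetCard.2 ⟨Finset.subset_univ _, ?_⟩
    rw [Finset.card_sdiff_of_subset hA'.2, h𝒜 hA'.1]
  · intro A hA B hB hAB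
    have hA' := Finset.mem_filter.1 hA
    have hB' := Finset.mem_filter.1 hB
    rw [← Finset.sdiff_union_of_subset hA'.2, ← Finset.sdiff_union_of_subset hB'.2]
    exact congrArg (· ∪ Q) hAB

/-- The members of `𝒜` all of whose pairs lie in many members of `𝒜`. -/
def richMembers (r : ℕ) (𝒜 : Finset (Finset (Fin n))) : Finset (Finset (Fin n)) :=
  𝒜.filter fun A => ∀ P ∈ A.powersetCard 2, r * n ^ (r - 3) < (𝒜.filter fun A => P ⊆ A).card

/-- Each discarded member contains a poor pair; there are at most n² pairs, each in at most r
n^(r-3) members. -/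
theorem card_le_card_richMembers_add (hr : 3 ≤ r) (𝒜 : Finset (Finset (Fin n))) :
    𝒜.card ≤ (richMembers r 𝒜).card + r * n ^ (r - 1) := by
  classical
  have hsub : 𝒜 ⊆ richMembers r 𝒜 ∪
      ((Finset.powersetCard 2 (Finset.univ : Finset (Fin n))).filter fun P =>
        (𝒜.filter fun A => P ⊆ A).card ≤ r * n ^ (r - 3)).biUnion
        fun P => 𝒜.filter fun A => P ⊆ A := by
    intro A hA
    by_cases h : A ∈ richMembers r 𝒜
    · exact Finset.mem_union_left _ h
    · refine Finset.mem_union_right _ ?_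
      simp only [richMembers, Finset.mem_filter, hA, true_and] at h
      push Not at h
      obtain ⟨P, hP, hle⟩ := h
      have hP' := Finset.mem_powersetCard.1 hP
      refine Finset.mem_biUnion.2 ⟨P, Finset.mem_filter.2 ⟨?_, hle⟩,
        Finset.mem_filter.2 ⟨hA, hP'.1⟩⟩
      exact Finset.mem_powersetCard.2 ⟨Finset.subset_univ _, hP'.2⟩
  refine (Finset.card_le_card hsub).trans ((Finset.card_union_le _ _).trans
    (Nat.add_le_add_left ?_ _))
  refine (Finset.card_biUnion_le_card_mul _ _ (r * n ^ (r - 3))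
    fun P hP => (Finset.mem_filter.1 hP).2).trans ?_
  have h1 : ((Finset.powersetCard 2 (Finset.univ : Finset (Fin n))).filter fun P =>
        (𝒜.filter fun A => P ⊆ A).card ≤ r * n ^ (r - 3)).card ≤ n ^ 2 := by
    refine (Finset.card_filter_le _ _).trans ?_
    rw [Finset.card_powersetCard, Finset.card_univ, Fintype.card_fin]
    exact Nat.choose_le_pow n 2
  refine (Nat.mul_le_mul_right _ h1).trans (le_of_eq ?_)
  obtain ⟨k, rfl⟩ := Nat.exists_eq_add_of_le' hr
  rw [Nat.add_sub_cancel, show k + 3 - 1 = k + 2 from rfl]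
  ring

/-- If `A ∩ B` contained a pair P, avoidance would force every member of 𝒜 through P to contain
another of the at most r points of `B \ P`. This allows at most r n^(r-3) members, contradicting
richness. Only 𝒜 has to be thinned. -/
theorem card_inter_le_one_of_mem_richMembers {𝒜 ℬ : Finset (Finset (Fin n))}
    (h𝒜 : (𝒜 : Set (Finset (Fin n))).Sized r) (hℬ : (ℬ : Set (Finset (Fin n))).Sized r)
    (h : CrossAvoiding 2 𝒜 ℬ) {A B : Finset (Fin n)} (hA : A ∈ richMembers r 𝒜) (hB : B ∈ ℬ) :
    (A ∩ B).card ≤ 1 := by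
  classical
  by_contra! hcard
  obtain ⟨P, hPs, hP2⟩ := Finset.exists_subset_card_eq (s := A ∩ B) (n := 2) hcard
  have hPA := hPs.trans Finset.inter_subset_left
  have hPB := hPs.trans Finset.inter_subset_right
  have hdeg := (Finset.mem_filter.1 hA).2 P (Finset.mem_powersetCard.2 ⟨hPA, hP2⟩)
  have hsub : (𝒜.filter fun A => P ⊆ A) ⊆
      (B \ P).biUnion fun z => 𝒜.filter fun A => insert z P ⊆ A := by
    intro A' hA'
    obtain ⟨hA', hP⟩ := Finset.mem_filter.1 hA'
    have hss : P ⊂ A' ∩ B := by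
      refine (Finset.subset_inter hP hPB).ssubset_of_ne fun he => h A' hA' B hB ?_
      rw [← he, hP2]
    obtain ⟨z, hz, hzP⟩ := Finset.exists_of_ssubset hss
    have hz' := Finset.mem_inter.1 hz
    refine Finset.mem_biUnion.2 ⟨z, Finset.mem_sdiff.2 ⟨hz'.2, hzP⟩,
      Finset.mem_filter.2 ⟨hA', Finset.insert_subset hz'.1 hP⟩⟩
  refine absurd hdeg (not_lt.2 ((Finset.card_le_card hsub).trans
    ((Finset.card_biUnion_le_card_mul _ _ (n ^ (r - 3)) fun z hz => ?_).trans
      (Nat.mul_le_mul_right _ ?_))))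
  · have := card_filter_superset_le h𝒜 (insert z P)
    rwa [Finset.card_insert_of_notMem (Finset.mem_sdiff.1 hz).2, hP2] at this
  · rw [← hℬ hB]
    exact Finset.card_le_card Finset.sdiff_subset

theorem card_mul_card_le_of_avoiding (hr : 3 ≤ r) {𝒜 ℬ : Finset (Finset (Fin n))}
    (h : UniformAvoidingPair n r 2 𝒜 ℬ) :
    (𝒜.card : ℝ) * ℬ.card ≤
      gammaConst r * (n : ℝ) ^ (2 * r) / (r.factorial : ℝ) ^ 2 + r * (n : ℝ) ^ (2 * r - 1) := by
  obtain ⟨h𝒜, hℬ, hav⟩ := h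
  have hs : ((richMembers r 𝒜 : Finset (Finset (Fin n))) : Set (Finset (Fin n))).Sized r :=
    fun A hA => h𝒜 (Finset.mem_filter.1 hA).1
  have h1 := card_mul_card_le_of_card_inter_le_one hr hs hℬ
    fun A hA B hB => card_inter_le_one_of_mem_richMembers h𝒜 hℬ hav hA hB
  have h2 : (𝒜.card : ℝ) ≤ (richMembers r 𝒜).card + r * (n : ℝ) ^ (r - 1) := by
    exact_mod_cast card_le_card_richMembers_add hr 𝒜
  have h3 : (ℬ.card : ℝ) ≤ (n : ℝ) ^ r := by
    exact_mod_cast (card_le_choose_of_sized hℬ).trans (Nat.choose_le_pow n r)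
  have h4 : ((richMembers r 𝒜).card : ℝ) * ℬ.card ≤
      gammaConst r * (n : ℝ) ^ (2 * r) / (r.factorial : ℝ) ^ 2 := by
    rw [le_div_iff₀ (by positivity)]; linarith
  have h5 : (r : ℝ) * (n : ℝ) ^ (r - 1) * ℬ.card ≤ r * (n : ℝ) ^ (2 * r - 1) := by
    have e : 2 * r - 1 = r - 1 + r := by omega
    rw [e, pow_add, ← mul_assoc]
    gcongr
  have h6 := mul_le_mul_of_nonneg_right h2 (Nat.cast_nonneg ℬ.card : (0 : ℝ) ≤ ℬ.card)
  linarith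

theorem disjointPairs_le (𝒜 ℬ : Finset (Finset (Fin n))) :
    disjointPairs 𝒜 ℬ ≤ 𝒜.card * ℬ.card := by
  rw [← Finset.card_product]
  exact Finset.card_filter_le _ _

/-- An intersecting pair is fixed by `B`, a common point, and the remaining r - 1 points of `A`. -/
theorem card_mul_card_le_disjointPairs_add (hr : 1 ≤ r) {𝒜 ℬ : Finset (Finset (Fin n))}
    (h𝒜 : (𝒜 : Set (Finset (Fin n))).Sized r) (hℬ : (ℬ : Set (Finset (Fin n))).Sized r) :
    𝒜.card * ℬ.card ≤ disjointPairs 𝒜 ℬ + r * n ^ (2 * r - 1) := by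
  classical
  rw [← Finset.card_product, disjointPairs,
    ← Finset.card_filter_add_card_filter_not (s := 𝒜 ×ˢ ℬ) (fun P => P.1 ∩ P.2 = ∅)]
  refine Nat.add_le_add_left ?_ _
  have hsub : ((𝒜 ×ˢ ℬ).filter fun P => ¬ P.1 ∩ P.2 = ∅) ⊆
      ℬ.biUnion fun B => (B.biUnion fun x => 𝒜.filter fun A => {x} ⊆ A).image fun A => (A, B) := by
    rintro ⟨A, B⟩ hP
    simp only [Finset.mem_filter, Finset.mem_product] at hP
    obtain ⟨⟨hA, hB⟩, hne⟩ := hP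
    obtain ⟨x, hx⟩ := Finset.nonempty_iff_ne_empty.2 hne
    have hx' := Finset.mem_inter.1 hx
    refine Finset.mem_biUnion.2 ⟨B, hB, Finset.mem_image.2 ⟨A, Finset.mem_biUnion.2
      ⟨x, hx'.2, Finset.mem_filter.2 ⟨hA, by simpa using hx'.1⟩⟩, rfl⟩⟩
  refine (Finset.card_le_card hsub).trans ((Finset.card_biUnion_le_card_mul _ _ (r * n ^ (r - 1))
    fun B hB => ?_).trans ?_)
  · refine Finset.card_image_le.trans ?_
    rw [← hℬ hB]
    refine Finset.card_biUnion_le_card_mul _ _ _ fun x _ => ?_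
    have := card_filter_superset_le h𝒜 {x}
    rw [hℬ hB]
    simpa using this
  · have h1 : ℬ.card ≤ n ^ r := (card_le_choose_of_sized hℬ).trans (Nat.choose_le_pow n r)
    refine (Nat.mul_le_mul_right _ h1).trans (le_of_eq ?_)
    have e : 2 * r - 1 = r - 1 + r := by omega
    rw [e, pow_add]; ring

theorem sized_starFamily (X : Finset (Fin n)) (s : ℕ) :
    ((starFamily r X s : Finset (Finset (Fin n))) : Set (Finset (Fin n))).Sized r := by
  intro F hF
  exact (Finset.mem_powersetCard.1 (Finset.mem_filter.1 hF).1).2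

/-- `B` lies outside `X` and `A` has at most one point there. -/
theorem uniformAvoidingPair_starFamily (X : Finset (Fin n)) :
    UniformAvoidingPair n r 2 (starFamily r X 1) (starFamily r Xᶜ 0) := by
  refine ⟨sized_starFamily X 1, sized_starFamily Xᶜ 0, fun A hA B hB => ?_⟩
  have hAr := sized_starFamily X 1 hA
  have hBr := sized_starFamily Xᶜ 0 hB
  have hA1 := (Finset.mem_filter.1 hA).2
  have hB1 := (Finset.mem_filter.1 hB).2
  have hBX : B ⊆ Xᶜ := by
    have : B ∩ Xᶜ = B := Finset.eq_of_subset_of_card_le Finset.inter_subset_left (by omega)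
    exact Finset.inter_eq_left.1 this
  have h1 : A ∩ B ⊆ A \ X := fun x hx => by
    have hx' := Finset.mem_inter.1 hx
    exact Finset.mem_sdiff.2 ⟨hx'.1, Finset.mem_compl.1 (hBX hx'.2)⟩
  have h2 := Finset.card_le_card h1
  have h3 := Finset.card_sdiff_add_card_inter A X
  omega

theorem card_starFamily_compl_zero (X : Finset (Fin n)) :
    (n - X.card).choose r ≤ (starFamily r Xᶜ 0).card := by
  have : (n - X.card).choose r = (Finset.powersetCard r Xᶜ).card := by
    rw [Finset.card_powersetCard, Finset.card_compl, Fintype.card_fin]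
  rw [this]
  refine Finset.card_le_card fun F hF => ?_
  have hF' := Finset.mem_powersetCard.1 hF
  refine Finset.mem_filter.2 ⟨Finset.mem_powersetCard.2 ⟨Finset.subset_univ _, hF'.2⟩, ?_⟩
  rw [Finset.inter_eq_left.2 hF'.1, hF'.2, add_zero]

/-- A lower bound is enough, since the matching upper bound for the product holds for every avoiding
pair. -/
theorem card_starFamily_one_ge (hr : 1 ≤ r) (X : Finset (Fin n)) :
    X.card.choose r + X.card.choose (r - 1) * (n - X.card) ≤ (starFamily r X 1).card := by
  classical
  set 𝒮 := (Finset.powersetCard (r - 1) X ×ˢ Xᶜ).image fun P => insert P.2 P.1 with h𝒮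
  have hcard : 𝒮.card = X.card.choose (r - 1) * (n - X.card) := by
    rw [h𝒮, Finset.card_image_of_injOn, Finset.card_product, Finset.card_powersetCard,
      Finset.card_compl, Fintype.card_fin]
    rintro ⟨S, v⟩ h1 ⟨T, w⟩ h2 he
    simp only [Finset.coe_product, Set.mem_prod, Finset.mem_coe, Finset.mem_powersetCard,
      Finset.mem_compl] at h1 h2
    simp only at he
    have hS : insert v S ∩ X = S := by
      rw [Finset.insert_inter_of_notMem h1.2, Finset.inter_eq_left.2 h1.1.1]
    have hT : insert w T ∩ X = T := by
      rw [Finset.insert_inter_of_notMem h2.2, Finset.inter_eq_left.2 h2.1.1]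
    have hST : S = T := by rw [← hS, ← hT, he]
    subst hST
    have hv : v ∈ insert w S := he ▸ Finset.mem_insert_self v S
    rcases Finset.mem_insert.1 hv with h | h
    · rw [h]
    · exact absurd (h1.1.1 h) h1.2
  have hdisj : Disjoint (Finset.powersetCard r X) 𝒮 := by
    rw [Finset.disjoint_left]
    intro F hF hF'
    obtain ⟨⟨S, v⟩, hP, rfl⟩ := Finset.mem_image.1 hF'
    have hP' := Finset.mem_product.1 hP
    exact Finset.mem_compl.1 hP'.2 ((Finset.mem_powersetCard.1 hF).1 (Finset.mem_insert_self _ _))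
  rw [← hcard, ← Finset.card_powersetCard, ← Finset.card_union_of_disjoint hdisj]
  refine Finset.card_le_card fun F hF => ?_
  rcases Finset.mem_union.1 hF with h | h
  · have h' := Finset.mem_powersetCard.1 h
    refine Finset.mem_filter.2 ⟨Finset.mem_powersetCard.2 ⟨Finset.subset_univ _, h'.2⟩, ?_⟩
    rw [Finset.inter_eq_left.2 h'.1, h'.2]; omega
  · obtain ⟨⟨S, v⟩, hP, rfl⟩ := Finset.mem_image.1 h
    have hP' := Finset.mem_product.1 hP
    have hS := Finset.mem_powersetCard.1 hP'.1
    have hv : v ∉ X := Finset.mem_compl.1 hP'.2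
    refine Finset.mem_filter.2 ⟨Finset.mem_powersetCard.2 ⟨Finset.subset_univ _, ?_⟩, ?_⟩
    · rw [Finset.card_insert_of_notMem fun hvS => hv (hS.1 hvS), hS.2]; omega
    · rw [Finset.insert_inter_of_notMem hv, Finset.inter_eq_left.2 hS.1, hS.2]; omega

end Counting

/-! ### Passage to the limit. -/

section Asymptotics

/-- Up to r! the binomial is a product of r factors, each divided by n and tending to β; truncation
in `x n - i` costs at most i. -/
theorem tendsto_choose_div_pow (r : ℕ) {x : ℕ → ℕ} {β : ℝ}
    (hx : Tendsto (fun n : ℕ => (x n : ℝ) / n) atTop (𝓝 β)) :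
    Tendsto (fun n : ℕ => ((x n).choose r : ℝ) / (n : ℝ) ^ r) atTop (𝓝 (β ^ r / r.factorial)) := by
  have hfac : ∀ i : ℕ, Tendsto (fun n : ℕ => ((x n - i : ℕ) : ℝ) / n) atTop (𝓝 β) := by
    intro i
    have h1 : Tendsto (fun n : ℕ => (x n : ℝ) / n - (i : ℝ) / n) atTop (𝓝 β) := by
      simpa using hx.sub (tendsto_const_div_atTop_nhds_zero_nat (i : ℝ))
    refine tendsto_of_tendsto_of_tendsto_of_le_of_le h1 hx (fun n => ?_) (fun n => ?_)
    · simp only [← sub_div]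
      gcongr
      have : (x n : ℝ) ≤ (x n - i : ℕ) + i := by exact_mod_cast le_tsub_add
      linarith
    · simp only
      gcongr
      exact Nat.sub_le _ _
  have hprod := tendsto_finsetProd (Finset.range r) fun i _ => hfac i
  rw [Finset.prod_const, Finset.card_range] at hprod
  refine (hprod.div_const (r.factorial : ℝ)).congr fun n => ?_
  rw [Finset.prod_div_distrib, Finset.prod_const, Finset.card_range, ← Nat.cast_prod,
    ← Nat.descFactorial_eq_prod_range, Nat.descFactorial_eq_factorial_mul_choose]
  push_cast
  have : (r.factorial : ℝ) ≠ 0 := by positivity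
  field_simp

theorem tendsto_self_choose_div_pow (r : ℕ) :
    Tendsto (fun n : ℕ => (n.choose r : ℝ) / (n : ℝ) ^ r) atTop (𝓝 (1 / r.factorial)) := by
  have h : Tendsto (fun n : ℕ => (n : ℝ) / n) atTop (𝓝 1) := by
    refine tendsto_const_nhds.congr' ?_
    filter_upwards [eventually_gt_atTop 0] with n hn
    rw [div_self]; positivity
  simpa using tendsto_choose_div_pow r (x := fun n => n) h

theorem tendsto_div_choose_sq {r : ℕ} {u : ℕ → ℝ} {c : ℝ}
    (hu : Tendsto (fun n : ℕ => u n / (n : ℝ) ^ (2 * r)) atTop (𝓝 c)) :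
    Tendsto (fun n : ℕ => u n / (n.choose r : ℝ) ^ 2) atTop (𝓝 (c * (r.factorial : ℝ) ^ 2)) := by
  have h := hu.div ((tendsto_self_choose_div_pow r).pow 2) (by positivity)
  have e : c / (1 / (r.factorial : ℝ)) ^ 2 = c * (r.factorial : ℝ) ^ 2 := by
    field_simp
  rw [e] at h
  refine h.congr' ?_
  filter_upwards [eventually_gt_atTop 0] with n hn
  have : (n : ℝ) ≠ 0 := by positivity
  simp only [Pi.div_apply, div_pow, ← pow_mul, mul_comm r 2]
  rw [div_div_div_cancel_right₀]
  positivity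

theorem tendsto_pow_pred_div_choose_sq {r : ℕ} (hr : 1 ≤ r) :
    Tendsto (fun n : ℕ => (r : ℝ) * (n : ℝ) ^ (2 * r - 1) / (n.choose r : ℝ) ^ 2) atTop (𝓝 0) := by
  have h : Tendsto (fun n : ℕ => (r : ℝ) * (n : ℝ) ^ (2 * r - 1) / (n : ℝ) ^ (2 * r)) atTop
      (𝓝 0) := by
    refine (tendsto_const_div_atTop_nhds_zero_nat (r : ℝ)).congr' ?_
    filter_upwards [eventually_gt_atTop 0] with n hn
    have : (n : ℝ) ≠ 0 := by positivity
    obtain ⟨k, hk⟩ : ∃ k, 2 * r = k + 1 := ⟨2 * r - 1, by omega⟩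
    rw [hk, Nat.add_sub_cancel, pow_succ]
    field_simp
  simpa using tendsto_div_choose_sq h

/-- The error term in the upper bound for the product. -/
noncomputable def productError (r n : ℕ) : ℝ :=
  gammaConst r * (n : ℝ) ^ (2 * r) / (r.factorial : ℝ) ^ 2 / (n.choose r : ℝ) ^ 2 - gammaConst r +
    r * (n : ℝ) ^ (2 * r - 1) / (n.choose r : ℝ) ^ 2

theorem tendsto_productError {r : ℕ} (hr : 1 ≤ r) : Tendsto (productError r) atTop (𝓝 0) := by
  have h1 : Tendsto (fun n : ℕ => gammaConst r * (n : ℝ) ^ (2 * r) / (r.factorial : ℝ) ^ 2 /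
      (n : ℝ) ^ (2 * r)) atTop (𝓝 (gammaConst r / (r.factorial : ℝ) ^ 2)) := by
    refine tendsto_const_nhds.congr' ?_
    filter_upwards [eventually_gt_atTop 0] with n hn
    have : (n : ℝ) ≠ 0 := by positivity
    field_simp
  have h2 := tendsto_div_choose_sq h1
  rw [div_mul_cancel₀ _ (by positivity)] at h2
  have h3 := (h2.sub_const (gammaConst r)).add (tendsto_pow_pred_div_choose_sq hr)
  rw [sub_self, zero_add] at h3
  exact h3

theorem card_mul_card_le_productError {n r : ℕ} (hr : 3 ≤ r) {𝒜 ℬ : Finset (Finset (Fin n))}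
    (h : UniformAvoidingPair n r 2 𝒜 ℬ) :
    (𝒜.card : ℝ) * ℬ.card ≤ (gammaConst r + productError r n) * (n.choose r : ℝ) ^ 2 := by
  -- For n < r the error term divides by zero, but then both sides of the inequality are 0.
  rcases Nat.eq_zero_or_pos (n.choose r) with h0 | h0
  · have h1 : 𝒜.card = 0 := by
      have := card_le_choose_of_sized h.1; omega
    simp [h0, h1]
  · refine (card_mul_card_le_of_avoiding hr h).trans (le_of_eq ?_)
    have : (n.choose r : ℝ) ≠ 0 := by positivity
    rw [productError]
    field_simp
    ring

theorem tendsto_starFamily_lower {r : ℕ} (hr : 1 ≤ r) {α : ℝ} {X : (n : ℕ) → Finset (Fin n)}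
    (hX : Tendsto (fun n : ℕ => ((X n).card : ℝ) / (n : ℝ)) atTop (𝓝 (1 - α))) :
    Tendsto (fun n : ℕ => (((X n).card.choose r + (X n).card.choose (r - 1) * (n - (X n).card) : ℕ) : ℝ) *
      ((n - (X n).card).choose r : ℕ) / (n.choose r : ℝ) ^ 2) atTop (𝓝 (gammaFun r α)) := by
  have hXc : Tendsto (fun n : ℕ => ((n - (X n).card : ℕ) : ℝ) / (n : ℝ)) atTop (𝓝 α) := by
    have : Tendsto (fun n : ℕ => 1 - ((X n).card : ℝ) / (n : ℝ)) atTop (𝓝 α) := by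
      simpa using hX.const_sub 1
    refine this.congr' ?_
    filter_upwards [eventually_gt_atTop 0] with n hn
    have hn' : (n : ℝ) ≠ 0 := by positivity
    have hle : (X n).card ≤ n := by simpa using (X n).card_le_univ
    rw [Nat.cast_sub hle]
    field_simp
  have h1 := tendsto_choose_div_pow r hX
  have h2 := tendsto_choose_div_pow (r - 1) hX
  have h3 := tendsto_choose_div_pow r hXc
  have h4 := (h1.add (h2.mul hXc)).mul h3
  obtain ⟨m, rfl⟩ := Nat.exists_eq_add_of_le' hr
  have h5 : Tendsto (fun n : ℕ => (((X n).card.choose (m + 1) + (X n).card.choose m * (n - (X n).card) : ℕ) : ℝ) *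
      ((n - (X n).card).choose (m + 1) : ℕ) / (n : ℝ) ^ (2 * (m + 1))) atTop
      (𝓝 (((1 - α) ^ (m + 1) / (m + 1).factorial + (1 - α) ^ m / m.factorial * α) *
        (α ^ (m + 1) / (m + 1).factorial))) := by
    refine h4.congr' ?_
    filter_upwards [eventually_gt_atTop 0] with n hn
    have hn' : (n : ℝ) ≠ 0 := by positivity
    simp only [Nat.add_sub_cancel]
    push_cast
    field_simp
    ring
  have h6 := tendsto_div_choose_sq h5
  have e : ((1 - α) ^ (m + 1) / (m + 1).factorial + (1 - α) ^ m / m.factorial * α) *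
      (α ^ (m + 1) / (m + 1).factorial) * ((m + 1).factorial : ℝ) ^ 2 = gammaFun (m + 1) α := by
    rw [gammaFun, Nat.factorial_succ]
    have : (m.factorial : ℝ) ≠ 0 := by positivity
    have : (m : ℝ) + 1 ≠ 0 := by positivity
    push_cast
    field_simp
    ring
  rwa [e] at h6

theorem tendsto_starFamily {r : ℕ} (hr : 3 ≤ r) {α : ℝ} (hα : gammaFun r α = gammaConst r)
    {X : (n : ℕ) → Finset (Fin n)}
    (hX : Tendsto (fun n : ℕ => ((X n).card : ℝ) / (n : ℝ)) atTop (𝓝 (1 - α))) :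
    Tendsto (fun n : ℕ => ((starFamily r (X n) 1).card : ℝ) *
      ((starFamily r (X n)ᶜ 0).card : ℝ) / (n.choose r : ℝ) ^ 2) atTop (𝓝 (gammaConst r)) ∧
    Tendsto (fun n : ℕ => (disjointPairs (starFamily r (X n) 1) (starFamily r (X n)ᶜ 0) : ℝ) /
      (n.choose r : ℝ) ^ 2) atTop (𝓝 (gammaConst r)) := by
  have hlow := tendsto_starFamily_lower (by omega : 1 ≤ r) hX
  rw [hα] at hlow
  have hup : Tendsto (fun n : ℕ => gammaConst r + productError r n) atTop (𝓝 (gammaConst r)) := by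
    simpa using (tendsto_productError (by omega : 1 ≤ r)).const_add (gammaConst r)
  have h1 : Tendsto (fun n : ℕ => ((starFamily r (X n) 1).card : ℝ) *
      ((starFamily r (X n)ᶜ 0).card : ℝ) / (n.choose r : ℝ) ^ 2) atTop (𝓝 (gammaConst r)) := by
    refine tendsto_of_tendsto_of_tendsto_of_le_of_le' hlow hup (Eventually.of_forall fun n => ?_) ?_
    · have h2 := card_starFamily_one_ge (r := r) (by omega) (X n)
      have h3 := card_starFamily_compl_zero (r := r) (X n)
      gcongr
    · filter_upwards [eventually_ge_atTop r] with n hn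
      have : 0 < n.choose r := Nat.choose_pos hn
      rw [div_le_iff₀ (by positivity)]
      exact card_mul_card_le_productError hr (uniformAvoidingPair_starFamily (X n))
  refine ⟨h1, ?_⟩
  have h2 := h1.sub (tendsto_pow_pred_div_choose_sq (by omega : 1 ≤ r))
  rw [sub_zero] at h2
  refine tendsto_of_tendsto_of_tendsto_of_le_of_le h2 h1 (fun n => ?_) (fun n => ?_)
  · have h3 : ((starFamily r (X n) 1).card : ℝ) * ((starFamily r (X n)ᶜ 0).card : ℝ) ≤
        disjointPairs (starFamily r (X n) 1) (starFamily r (X n)ᶜ 0) + r * (n : ℝ) ^ (2 * r - 1) := by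
      exact_mod_cast card_mul_card_le_disjointPairs_add (by omega : 1 ≤ r)
        (sized_starFamily (X n) 1) (sized_starFamily (X n)ᶜ 0)
    simp only [← sub_div]
    gcongr
    linarith
  · simp only
    gcongr
    exact_mod_cast disjointPairs_le _ _

theorem exists_tendsto_card_div {β : ℝ} (h0 : 0 ≤ β) (h1 : β ≤ 1) :
    ∃ X : (n : ℕ) → Finset (Fin n),
      Tendsto (fun n : ℕ => ((X n).card : ℝ) / (n : ℝ)) atTop (𝓝 β) := by
  have hex : ∀ n : ℕ, ∃ X : Finset (Fin n), X.card = ⌊β * n⌋₊ := by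
    intro n
    have hle : ⌊β * n⌋₊ ≤ (Finset.univ : Finset (Fin n)).card := by
      rw [Finset.card_univ, Fintype.card_fin]
      refine Nat.floor_le_of_le ?_
      exact mul_le_of_le_one_left (Nat.cast_nonneg n) h1
    obtain ⟨X, -, hX⟩ := Finset.exists_subset_card_eq hle
    exact ⟨X, hX⟩
  choose X hX using hex
  refine ⟨X, ?_⟩
  simp only [hX]
  exact (tendsto_nat_floor_mul_div_atTop h0).comp tendsto_natCast_atTop_atTop

end Asymptotics

theorem theorem1p8 (r : ℕ) (hr : 3 ≤ r) :
    -- the upper bound, with an error term depending only on `r` and `n`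
    (∃ e : ℕ → ℝ, Tendsto e atTop (𝓝 0) ∧
      ∀ (n : ℕ) (𝒜 ℬ : Finset (Finset (Fin n))), UniformAvoidingPair n r 2 𝒜 ℬ →
        (𝒜.card : ℝ) * (ℬ.card : ℝ) ≤ (gammaConst r + e n) * (n.choose r : ℝ) ^ 2) ∧
    -- asymptotic tightness: the maximum product is `(γ_r + o(1)) (n choose r)^2`
    Tendsto (fun n : ℕ => (maxProduct n r 2 : ℝ) / (n.choose r : ℝ) ^ 2) atTop
      (𝓝 (gammaConst r)) ∧
    -- the maximum number of disjoint pairs is `(γ_r + o(1)) (n choose r)^2`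
    Tendsto (fun n : ℕ => (maxDisjoint n r 2 : ℝ) / (n.choose r : ℝ) ^ 2) atTop
      (𝓝 (gammaConst r)) ∧
    -- explicit asymptotically extremal pairs for both problems
    (∀ α ∈ Set.Icc (0 : ℝ) 1, gammaFun r α = gammaConst r →
      ∀ X : (n : ℕ) → Finset (Fin n),
        Tendsto (fun n : ℕ => ((X n).card : ℝ) / (n : ℝ)) atTop (𝓝 (1 - α)) →
        (∀ n : ℕ, UniformAvoidingPair n r 2 (starFamily r (X n) 1) (starFamily r (X n)ᶜ 0)) ∧
        Tendsto (fun n : ℕ => ((starFamily r (X n) 1).card : ℝ) *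
          ((starFamily r (X n)ᶜ 0).card : ℝ) / (n.choose r : ℝ) ^ 2) atTop
          (𝓝 (gammaConst r)) ∧
        Tendsto (fun n : ℕ =>
          (disjointPairs (starFamily r (X n) 1) (starFamily r (X n)ᶜ 0) : ℝ) /
            (n.choose r : ℝ) ^ 2) atTop (𝓝 (gammaConst r))) := by
  refine ⟨⟨productError r, tendsto_productError (by omega), fun n 𝒜 ℬ h =>
    card_mul_card_le_productError hr h⟩, ?_⟩
  obtain ⟨α, hα, hαeq⟩ := (gammaConst_isGreatest r).1
  obtain ⟨X, hX⟩ := exists_tendsto_card_div (sub_nonneg.2 hα.2) (by linarith [hα.1] : 1 - α ≤ 1)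
  have hup : Tendsto (fun n : ℕ => gammaConst r + productError r n) atTop (𝓝 (gammaConst r)) := by
    simpa using (tendsto_productError (by omega : 1 ≤ r)).const_add (gammaConst r)
  refine ⟨?_, ?_, fun β _ hβ Y hY => ⟨fun n => uniformAvoidingPair_starFamily (Y n),
    tendsto_starFamily hr hβ hY⟩⟩
  · refine tendsto_of_tendsto_of_tendsto_of_le_of_le' (tendsto_starFamily hr hαeq hX).1 hup
      (Eventually.of_forall fun n => ?_) ?_
    · gcongr
      exact_mod_cast (maxProduct_isGreatest n r 2).2
        ⟨_, _, uniformAvoidingPair_starFamily (X n), rfl⟩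
    · filter_upwards [eventually_ge_atTop r] with n hn
      have : 0 < n.choose r := Nat.choose_pos hn
      obtain ⟨𝒜, ℬ, h, he⟩ := (maxProduct_isGreatest n r 2).1
      rw [div_le_iff₀ (by positivity), he]
      push_cast
      exact card_mul_card_le_productError hr h
  · refine tendsto_of_tendsto_of_tendsto_of_le_of_le' (tendsto_starFamily hr hαeq hX).2 hup
      (Eventually.of_forall fun n => ?_) ?_
    · gcongr
      exact_mod_cast (maxDisjoint_isGreatest n r 2).2
        ⟨_, _, uniformAvoidingPair_starFamily (X n), rfl⟩
    · filter_upwards [eventually_ge_atTop r] with n hn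
      have : 0 < n.choose r := Nat.choose_pos hn
      obtain ⟨𝒜, ℬ, h, he⟩ := (maxDisjoint_isGreatest n r 2).1
      rw [div_le_iff₀ (by positivity), he]
      refine le_trans ?_ (card_mul_card_le_productError hr h)
      exact_mod_cast disjointPairs_le 𝒜 ℬ
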